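/- Let $d\ge 2$, let $\sigma$ be the surface measure on $\mathbb S^{d-1}=\{x\in\mathbb R^d:\|x\|=1\}$, and for each $\ell\in\mathbb N_0$ let $(S_{\ell m},\ m=1,\dots,h(\ell,d))$ be a basis, orthonormal in $L^2(\mathbb S^{d-1})$, of the space of real spherical harmonics of degree $\ell$ (restrictions to $\mathbb S^{d-1}$ of harmonic homogeneous polynomials of degree $\ell$), where $h(\ell,d)=(2\ell+d-2)\frac{(\ell+d-3)!}{(d-2)!\,\ell!}$ for $\ell\ge1$ and $h(0,d)=1$. Let $T:\Omega\times\mathbb S^{d-1}\to\mathbb R$ be a Gaussian isotropic random field on a probability space $(\Omega,\mathcal A,\mathbb P)$: $T$ is jointly measurable, its finite-dimensional distributions are Gaussian (possibly degenerate), $\mathbb E(T(x))$ does not depend on $x$, and the covariance of $T(x)$ and $T(y)$ depends only on the angular distance $\arccos\langle x,y\rangle$. Let $$a_{\ell m}=\int_{\mathbb S^{d-1}}T(y)S_{\ell m}(y)\,d\sigma(y),\qquad T^\kappa=\sum_{\ell=0}^{\kappa}\sum_{m=1}^{h(\ell,d)}a_{\ell m}S_{\ell m}\quad(\kappa\in\mathbb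 N)$$ be its Karhunen--Loève coefficients and truncated Karhunen--Loève expansions, and let $(A_\ell,\ell\in\mathbb N_0)$ be its angular power spectrum, i.e. $A_\ell$ is the common variance of $a_{\ell 1},\dots,a_{\ell h(\ell,d)}$. **Theorem.** Let $\alpha>2$, $C>0$, $\ell_0\in\mathbb N$, and suppose that $A_\ell\le C\ell^{-\alpha}$ for all $\ell>\ell_0$. Then for every finite $p\ge1$ the fields $T^\kappa$ converge to $T$ in $L^p(\Omega;L^2(\mathbb S^{d-1}))$ as $\kappa\to\infty$, and there is a constant $C_p>0$ such that $$\|T-T^\kappa\|_{L^p(\Omega;L^2(\mathbb S^{d-1}))}\le C_p\,\kappa^{-(\alpha+1-d)/2}\qquad\text{for all }\kappa\in\mathbb N,\ \kappa\ge\ell_0.$$ If $\alpha>d-1$, then $C_p$ can be chosen to depend only on $d$, $p$, $\alpha$ and $C$; if $2<\alpha\le d-1$, then $C_p$ may depend on $T$ as well. Furthermore, $\mathbb P$-almost surely $T^\kappa$ converges to $T$ in $L^2(\mathbb S^{d-1})$, and for every real $\beta<(\alpha+1-d)/2$ there is $\mathbb P$-almost surely a (random) $\kappa_0$ such that $$\|T-T^\kappa\|_{L^2(\mathbb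 S^{d-1})}\le\kappa^{-\beta}\qquad\text{for all }\kappa\ge\kappa_0.$$ -/

import Mathlib

open MeasureTheory ProbabilityTheory Filter Topology
open scoped ENNReal

universe u

noncomputable section

namespace SphereField

/-- The unit sphere `𝕊^{d-1}` of the Euclidean space `ℝ^d`. -/
abbrev Sph (d : ℕ) : Type := Metric.sphere (0 : EuclideanSpace ℝ (Fin d)) 1

/-- The surface (Lebesgue) measure on `𝕊^{d-1}`, not normalized. -/
def surf (d : ℕ) : Measure (Sph d) :=
  (volume : Measure (EuclideanSpace ℝ (Fin d))).toSphere

/-- The number `h(ℓ,d) = (2ℓ+d-2) (ℓ+d-3)! / ((d-2)! ℓ!)` of linearly independent spherical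
harmonics of degree `ℓ` on `𝕊^{d-1}`, `d ≥ 2`. In degree `0` its value is `1` (for `d = 2` the
closed formula would involve `(-1)!` there). -/
def harmDim (ℓ d : ℕ) : ℕ :=
  if ℓ = 0 then 1
  else (2 * ℓ + d - 2) * (ℓ + d - 3).factorial / ((d - 2).factorial * ℓ.factorial)

/-- The Laplacian of a polynomial in `d` variables. -/
def polyLaplacian {d : ℕ} (p : MvPolynomial (Fin d) ℝ) : MvPolynomial (Fin d) ℝ :=
  ∑ i, MvPolynomial.pderiv i (MvPolynomial.pderiv i p)

/-- The space `ℋ_ℓ(𝕊^{d-1})` of spherical harmonics of degree `ℓ`: restrictions to the sphere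
of harmonic homogeneous polynomials of degree `ℓ` on `ℝ^d`. -/
def harmonicSpace (d ℓ : ℕ) : Submodule ℝ (Sph d → ℝ) where
  carrier := {f | ∃ p : MvPolynomial (Fin d) ℝ, p.IsHomogeneous ℓ ∧ polyLaplacian p = 0 ∧
    ∀ x : Sph d, f x = MvPolynomial.eval (fun i => (x : EuclideanSpace ℝ (Fin d)) i) p}
  add_mem' := by
    rintro f g ⟨p, hp, hp0, hf⟩ ⟨q, hq, hq0, hg⟩
    refine ⟨p + q, hp.add hq, ?_, fun x => by simp [hf, hg]⟩
    simp only [polyLaplacian, map_add, Finset.sum_add_distrib] at *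
    rw [hp0, hq0, add_zero]
  zero_mem' := ⟨0, MvPolynomial.isHomogeneous_zero _ _ _, by simp [polyLaplacian], by simp⟩
  smul_mem' := by
    rintro c f ⟨p, hp, hp0, hf⟩
    refine ⟨MvPolynomial.C c * p, by simpa using (MvPolynomial.isHomogeneous_C _ c).mul hp,
      ?_, fun x => by simp [hf]⟩
    simp only [polyLaplacian, MvPolynomial.pderiv_C_mul] at *
    rw [← Finset.mul_sum, hp0, mul_zero]

/-- The real spherical harmonics `S_{ℓm}`, `ℓ ∈ ℕ₀`, `m = 1, …, h(ℓ,d)`, on `𝕊^{d-1}`: in every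
degree `ℓ`, they are a basis of `ℋ_ℓ(𝕊^{d-1})`, orthonormal with respect to the surface measure. -/
structure IsSphericalHarmonics (d : ℕ) (S : (ℓ : ℕ) → Fin (harmDim ℓ d) → Sph d → ℝ) : Prop where
  span_eq : ∀ ℓ, Submodule.span ℝ (Set.range (S ℓ)) = harmonicSpace d ℓ
  orthonormal : ∀ ℓ m m', ∫ x, S ℓ m x * S ℓ m' x ∂(surf d) = if m = m' then 1 else 0

variable {d : ℕ} {Ω : Type*} [MeasurableSpace Ω]

/-- A real-valued Gaussian isotropic random field on `𝕊^{d-1}`: a jointly measurable map all of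
whose finite-dimensional distributions are (possibly degenerate) Gaussian, whose mean is constant
and whose covariance is a function of the angular distance `arccos ⟨x, y⟩`. -/
structure IsGaussianIsotropic (T : Sph d → Ω → ℝ) (P : Measure Ω) : Prop where
  measurable : Measurable (fun z : Ω × Sph d => T z.2 z.1)
  gaussian : IsGaussianProcess T P
  mean_const : ∃ μ : ℝ, ∀ x, P[T x] = μ
  cov_isotropic : ∃ k : ℝ → ℝ, ∀ x y : Sph d, cov[T x, T y; P] =
    k (Real.arccos (inner ℝ (x : EuclideanSpace ℝ (Fin d)) (y : EuclideanSpace ℝ (Fin d))))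

/-- The Karhunen–Loève coefficient `a_{ℓm} = ∫ T(y) S_{ℓm}(y) dσ(y)`. -/
def klCoeff (S : (ℓ : ℕ) → Fin (harmDim ℓ d) → Sph d → ℝ) (T : Sph d → Ω → ℝ)
    (ℓ : ℕ) (m : Fin (harmDim ℓ d)) (ω : Ω) : ℝ :=
  ∫ y, T y ω * S ℓ m y ∂(surf d)

/-- The sequence `A` is the angular power spectrum of `T`: `A_ℓ` is the variance of each of the
Karhunen–Loève coefficients `a_{ℓm}`, `m = 1, …, h(ℓ,d)`, of degree `ℓ`. -/
def IsAngularPowerSpectrum (S : (ℓ : ℕ) → Fin (harmDim ℓ d) → Sph d → ℝ)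
    (T : Sph d → Ω → ℝ) (P : Measure Ω) (A : ℕ → ℝ) : Prop :=
  ∀ ℓ m, Var[klCoeff S T ℓ m; P] = A ℓ

/-- The truncated Karhunen–Loève expansion `T^κ = ∑_{ℓ ≤ κ} ∑_m a_{ℓm} S_{ℓm}`. -/
def truncKL (S : (ℓ : ℕ) → Fin (harmDim ℓ d) → Sph d → ℝ) (T : Sph d → Ω → ℝ)
    (κ : ℕ) (x : Sph d) (ω : Ω) : ℝ :=
  ∑ ℓ ∈ Finset.range (κ + 1), ∑ m, klCoeff S T ℓ m ω * S ℓ m x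

/-- The pathwise truncation error `‖T - T^κ‖_{L²(𝕊^{d-1})}` (`∞` if the difference is not
square integrable). -/
def truncError (S : (ℓ : ℕ) → Fin (harmDim ℓ d) → Sph d → ℝ) (T : Sph d → Ω → ℝ)
    (κ : ℕ) (ω : Ω) : ℝ≥0∞ :=
  eLpNorm (fun x => T x ω - truncKL S T κ x ω) 2 (surf d)

/-- The truncation error `‖T - T^κ‖_{L^p(Ω; L²(𝕊^{d-1}))}`. -/
def truncErrorLp (S : (ℓ : ℕ) → Fin (harmDim ℓ d) → Sph d → ℝ) (T : Sph d → Ω → ℝ)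
    (P : Measure Ω) (p : ℝ) (κ : ℕ) : ℝ≥0∞ :=
  (∫⁻ ω, truncError S T κ ω ^ p ∂P) ^ (1 / p)

end SphereField

end

namespace SphereField

/-! Spherical harmonics form a Hilbert basis of L² of the sphere, so by Parseval ‖T - T^κ‖² is
almost surely the sum of a_{ℓm}² over ℓ > κ. For ℓ ≥ 1 the a_{ℓm} are centred with variance A_ℓ, so
the expectation of this sum is ∑_{ℓ>κ} h(ℓ,d) A_ℓ. As h(ℓ,d) ≤ d ℓ^(d-2), this is O(κ^(-(α+1-d)))
when α > d-1 (`tailEnergy_le`). When α ≤ d-1 the claimed rate does not decay, and finiteness of the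
total energy suffices.

Higher moments need no independence of the coefficients. Each a_{ℓm} lies in the closed linear span
of the T(x) in L²(Ω), where E|Z|^(2n) ≤ c_n (E Z²)^n passes from Gaussian combinations to limits
(`lintegral_klCoeff_pow_le`). Minkowski's inequality in L^n for the sum of the a_{ℓm}² then bounds
every L^p error by the square root of the expected tail energy (`truncErrorLp_le`). The almost sure
rate follows by Markov's inequality for large p and Borel–Cantelli.

The basis property is proved from scratch. Orthogonality across degrees is Green's identity against
the cutoff (1-|x|²)₊², transferred to the sphere by polar coordinates
(`integral_harmonic_mul_eq_zero`). Completeness is the decomposition of polynomials on the sphere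
into harmonics (`polyFun_mem_iSup_harmonicSpace`) together with Stone–Weierstrass. -/

open MvPolynomial in
/-- The polynomial function on `ℝ^d` given by a polynomial in `d` variables. -/
noncomputable def polyFun {d : ℕ} (p : MvPolynomial (Fin d) ℝ) (x : EuclideanSpace ℝ (Fin d)) : ℝ :=
  eval (fun i => x i) p

/-! ### Polynomial functions and their derivatives -/

section PolyFun

variable {d : ℕ}

@[simp] lemma polyFun_add (p q : MvPolynomial (Fin d) ℝ) (x : EuclideanSpace ℝ (Fin d)) :
    polyFun (p + q) x = polyFun p x + polyFun q x := by simp [polyFun]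

@[simp] lemma polyFun_sub (p q : MvPolynomial (Fin d) ℝ) (x : EuclideanSpace ℝ (Fin d)) :
    polyFun (p - q) x = polyFun p x - polyFun q x := by simp [polyFun]

@[simp] lemma polyFun_mul (p q : MvPolynomial (Fin d) ℝ) (x : EuclideanSpace ℝ (Fin d)) :
    polyFun (p * q) x = polyFun p x * polyFun q x := by simp [polyFun]

@[simp] lemma polyFun_C (c : ℝ) (x : EuclideanSpace ℝ (Fin d)) :
    polyFun (MvPolynomial.C c) x = c := by simp [polyFun]

@[simp] lemma polyFun_X (i : Fin d) (x : EuclideanSpace ℝ (Fin d)) :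
    polyFun (MvPolynomial.X i) x = x i := by simp [polyFun]

lemma polyFun_sum {ι : Type*} (s : Finset ι) (p : ι → MvPolynomial (Fin d) ℝ)
    (x : EuclideanSpace ℝ (Fin d)) : polyFun (∑ i ∈ s, p i) x = ∑ i ∈ s, polyFun (p i) x := by
  simp [polyFun]

lemma continuous_polyFun (p : MvPolynomial (Fin d) ℝ) : Continuous (polyFun p) := by
  unfold polyFun
  have : Continuous fun x : EuclideanSpace ℝ (Fin d) => (fun i => x i) := by fun_prop
  exact (MvPolynomial.continuous_eval p).comp this

lemma polyFun_smul {n : ℕ} {p : MvPolynomial (Fin d) ℝ} (hp : p.IsHomogeneous n) (c : ℝ)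
    (x : EuclideanSpace ℝ (Fin d)) : polyFun p (c • x) = c ^ n * polyFun p x := by
  simp only [polyFun, MvPolynomial.eval_eq', Finset.mul_sum]
  refine Finset.sum_congr rfl fun e he => ?_
  have hn : ∑ i, e i = n := by
    rw [← Finsupp.degree_eq_sum, Finsupp.degree_eq_weight_one]
    exact hp (MvPolynomial.mem_support_iff.1 he)
  simp only [PiLp.smul_apply, smul_eq_mul, mul_pow, Finset.prod_mul_distrib,
    Finset.prod_pow_eq_pow_sum, hn]
  ring

lemma eq_zero_of_polyFun_eq_zero {p : MvPolynomial (Fin d) ℝ} (h : ∀ x, polyFun p x = 0) :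
    p = 0 :=
  MvPolynomial.funext fun x => by simpa [polyFun] using h (WithLp.toLp 2 x)

/-- The derivative of a polynomial function. -/
lemma hasFDerivAt_polyFun (p : MvPolynomial (Fin d) ℝ) (x : EuclideanSpace ℝ (Fin d)) :
    HasFDerivAt (polyFun p)
      (∑ i, polyFun (MvPolynomial.pderiv i p) x • EuclideanSpace.proj (𝕜 := ℝ) i) x := by
  induction p using MvPolynomial.induction_on with
  | C a =>
    have : polyFun (MvPolynomial.C a : MvPolynomial (Fin d) ℝ) = fun _ => a := by ext; simp
    rw [this]
    convert hasFDerivAt_const a x using 1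
    simp [polyFun]
  | add p q hp hq =>
    have : polyFun (p + q) = polyFun p + polyFun q := by ext; simp
    rw [this]
    refine (hp.add hq).congr_fderiv ?_
    simp [add_smul, Finset.sum_add_distrib]
  | mul_X p j hp =>
    have : polyFun (p * MvPolynomial.X j) = polyFun p * fun x => x j := by ext; simp
    rw [this]
    have hj : HasFDerivAt (fun x : EuclideanSpace ℝ (Fin d) => x j)
        (EuclideanSpace.proj (𝕜 := ℝ) j) x := (EuclideanSpace.proj (𝕜 := ℝ) j).hasFDerivAt
    refine (hp.mul hj).congr_fderiv ?_
    ext v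
    have h1 : ∀ i, polyFun (MvPolynomial.pderiv i (MvPolynomial.X j : MvPolynomial (Fin d) ℝ)) x =
        if i = j then 1 else 0 := fun i => by
      rw [MvPolynomial.pderiv_X, Pi.single_apply]
      simp only [eq_comm (a := j)]
      split_ifs <;> simp [polyFun]
    simp only [Derivation.leibniz, smul_eq_mul, polyFun_add, polyFun_mul, h1, polyFun_X]
    simp [add_mul, Finset.sum_add_distrib, Finset.mul_sum, mul_assoc]

lemma differentiable_polyFun (p : MvPolynomial (Fin d) ℝ) : Differentiable ℝ (polyFun p) :=
  fun x => (hasFDerivAt_polyFun p x).differentiableAt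

lemma fderiv_polyFun_single (p : MvPolynomial (Fin d) ℝ) (x : EuclideanSpace ℝ (Fin d))
    (i : Fin d) : fderiv ℝ (polyFun p) x (EuclideanSpace.single i 1) =
      polyFun (MvPolynomial.pderiv i p) x := by
  rw [(hasFDerivAt_polyFun p x).fderiv]
  simp

end PolyFun

/-! ### Integration by parts against a radial cutoff -/

section Cutoff

/-- Squaring smooths the kink of the positive part: at 0 the function is O(v²) = o(v). This makes
the squared cutoff differentiable everywhere. -/
lemma hasDerivAt_max_zero_sq (u : ℝ) :
    HasDerivAt (fun u : ℝ => max 0 u ^ 2) (2 * max 0 u) u := by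
  rcases lt_trichotomy u 0 with hu | rfl | hu
  · rw [max_eq_left hu.le, mul_zero]
    refine (hasDerivAt_const u (0 : ℝ)).congr_of_eventuallyEq ?_
    filter_upwards [Iio_mem_nhds hu] with v hv
    simp [max_eq_left (Set.mem_Iio.1 hv).le]
  · simp only [max_self, mul_zero]
    rw [hasDerivAt_iff_isLittleO]
    simp only [max_self, ne_eq, OfNat.ofNat_ne_zero, not_false_eq_true, zero_pow, sub_zero,
      smul_zero]
    refine Asymptotics.IsBigO.trans_isLittleO (g := fun x : ℝ => x ^ 2) ?_ ?_
    · refine Asymptotics.IsBigO.of_bound 1 (Eventually.of_forall fun v => ?_)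
      simp only [norm_pow, Real.norm_eq_abs, one_mul]
      rw [abs_of_nonneg (le_max_left 0 v)]
      gcongr
      exact max_le (abs_nonneg _) (le_abs_self _)
    · simpa using Asymptotics.isLittleO_pow_pow (𝕜 := ℝ) (m := 1) (n := 2) (by norm_num)
  · rw [max_eq_right hu.le]
    have := (hasDerivAt_pow 2 u)
    simp only [Nat.cast_ofNat, Nat.add_one_sub_one, pow_one] at this
    refine this.congr_of_eventuallyEq ?_
    filter_upwards [Ioi_mem_nhds hu] with v hv
    simp [max_eq_right (Set.mem_Ioi.1 hv).le]

variable {d : ℕ}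

/-- The radial profile `(1 - r²)₊`. -/
noncomputable def profile (r : ℝ) : ℝ := max 0 (1 - r ^ 2)

lemma continuous_profile : Continuous profile := by unfold profile; fun_prop

lemma profile_nonneg (r : ℝ) : 0 ≤ profile r := le_max_left _ _

lemma profile_eq_zero {r : ℝ} (hr : 1 ≤ r) : profile r = 0 :=
  max_eq_left (by nlinarith)

lemma profile_pos {r : ℝ} (h0 : 0 ≤ r) (hr : r < 1) : 0 < profile r :=
  lt_max_of_lt_right (by nlinarith)

lemma hasFDerivAt_profile_norm_sq (x : EuclideanSpace ℝ (Fin d)) :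
    HasFDerivAt (fun x : EuclideanSpace ℝ (Fin d) => profile ‖x‖ ^ 2)
      ((2 * profile ‖x‖) • -((2 : ℝ) • innerSL ℝ x)) x := by
  have h1 : HasFDerivAt (fun x : EuclideanSpace ℝ (Fin d) => 1 - ‖x‖ ^ 2)
      (-((2 : ℝ) • innerSL ℝ x)) x := by
    refine (((hasStrictFDerivAt_norm_sq x).hasFDerivAt).const_sub 1).congr_fderiv ?_
    rw [two_smul, two_smul]
  exact (hasDerivAt_max_zero_sq (1 - ‖x‖ ^ 2)).comp_hasFDerivAt (f := fun x => 1 - ‖x‖ ^ 2) x h1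

lemma fderiv_profile_norm_sq_single (x : EuclideanSpace ℝ (Fin d)) (i : Fin d) :
    fderiv ℝ (fun x : EuclideanSpace ℝ (Fin d) => profile ‖x‖ ^ 2) x (EuclideanSpace.single i 1) =
      -(4 * (x i * profile ‖x‖)) := by
  rw [(hasFDerivAt_profile_norm_sq x).fderiv]
  simp [EuclideanSpace.inner_single_right]
  ring

lemma integrable_of_profile {f : EuclideanSpace ℝ (Fin d) → ℝ} (hf : Continuous f)
    (h0 : ∀ x, 1 ≤ ‖x‖ → f x = 0) : Integrable f := by
  refine hf.integrable_of_hasCompactSupport ?_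
  refine HasCompactSupport.intro (isCompact_closedBall (0 : EuclideanSpace ℝ (Fin d)) 1) fun x hx => ?_
  exact h0 x (by simpa using (not_le.1 (by simpa using hx)).le)

/-- Integration by parts of a polynomial against the cutoff function `(1 - |x|²)₊²`. -/
lemma integral_pderiv_mul_profile (f : MvPolynomial (Fin d) ℝ) (i : Fin d) :
    ∫ x, polyFun (MvPolynomial.pderiv i f) x * profile ‖x‖ ^ 2 =
      ∫ x, 4 * (polyFun (MvPolynomial.X i * f) x * profile ‖x‖) := by
  have hc := continuous_profile
  have hf := continuous_polyFun f
  have hf' := continuous_polyFun (MvPolynomial.pderiv i f)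
  have key := integral_mul_fderiv_eq_neg_fderiv_mul_of_integrable (μ := volume)
    (f := polyFun f) (g := fun x : EuclideanSpace ℝ (Fin d) => profile ‖x‖ ^ 2)
    (v := EuclideanSpace.single i 1) ?_ ?_ ?_ (fun x _ => differentiable_polyFun f x)
    (fun x _ => (hasFDerivAt_profile_norm_sq x).differentiableAt)
  · simp only [fderiv_polyFun_single, fderiv_profile_norm_sq_single] at key
    rw [← neg_inj, ← key, ← integral_neg]
    congr 1
    ext x
    simp
    ring
  · simp only [fderiv_polyFun_single]
    exact integrable_of_profile (by fun_prop) fun x hx => by simp [profile_eq_zero hx]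
  · simp only [fderiv_profile_norm_sq_single]
    exact integrable_of_profile (by fun_prop) fun x hx => by simp [profile_eq_zero hx]
  · exact integrable_of_profile (by fun_prop) fun x hx => by simp [profile_eq_zero hx]

end Cutoff

instance (d : ℕ) : IsFiniteMeasure (surf d) := by unfold surf; infer_instance

/-! ### Orthogonality of harmonics of different degrees -/

section Orthogonality

variable {d : ℕ}

/-- The field F = p∇q - q∇p is divergence free, and x·F = (b - a)pq by Euler's identity. Since the
gradient of (1-|x|²)₊² is -4x(1-|x|²)₊, integrating div F against it gives 0 = 4(b - a)∫ pq
(1-|x|²)₊. -/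
lemma integral_harmonic_mul_profile_eq_zero {a b : ℕ} (hab : a ≠ b)
    {p q : MvPolynomial (Fin d) ℝ} (hp : p.IsHomogeneous a) (hq : q.IsHomogeneous b)
    (hp0 : polyLaplacian p = 0) (hq0 : polyLaplacian q = 0) :
    ∫ x, polyFun (p * q) x * profile ‖x‖ = 0 := by
  have hc := continuous_profile
  set f : Fin d → MvPolynomial (Fin d) ℝ := fun i =>
    p * MvPolynomial.pderiv i q - q * MvPolynomial.pderiv i p with hf
  have hdiv : ∑ i, MvPolynomial.pderiv i (f i) = 0 := by
    have : ∀ i, MvPolynomial.pderiv i (f i) =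
        p * MvPolynomial.pderiv i (MvPolynomial.pderiv i q) -
          q * MvPolynomial.pderiv i (MvPolynomial.pderiv i p) := fun i => by
      simp only [hf, map_sub, MvPolynomial.pderiv_mul]; ring
    simp only [this, Finset.sum_sub_distrib, ← Finset.mul_sum]
    simp only [polyLaplacian] at hp0 hq0
    simp [hp0, hq0]
  have hX : ∑ i, MvPolynomial.X i * f i = MvPolynomial.C ((b : ℝ) - a) * (p * q) := by
    have h1 := hp.sum_X_mul_pderiv
    have h2 := hq.sum_X_mul_pderiv
    have : ∀ i, MvPolynomial.X i * f i = p * (MvPolynomial.X i * MvPolynomial.pderiv i q) -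
        q * (MvPolynomial.X i * MvPolynomial.pderiv i p) := fun i => by simp only [hf]; ring
    simp only [this, Finset.sum_sub_distrib, ← Finset.mul_sum, h1, h2]
    simp
    ring
  have hi : ∀ g : MvPolynomial (Fin d) ℝ, Continuous (polyFun g) := continuous_polyFun
  have key : ∑ i, ∫ x, polyFun (MvPolynomial.pderiv i (f i)) x * profile ‖x‖ ^ 2 =
      ∑ i, ∫ x, 4 * (polyFun (MvPolynomial.X i * f i) x * profile ‖x‖) :=
    Finset.sum_congr rfl fun i _ => integral_pderiv_mul_profile _ _
  rw [← integral_finsetSum, ← integral_finsetSum] at key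
  · simp only [← Finset.sum_mul, ← Finset.mul_sum, ← polyFun_sum, hdiv, hX] at key
    simp only [polyFun_mul _ (p * q), polyFun_C, mul_assoc, integral_const_mul] at key
    have h0 : polyFun (0 : MvPolynomial (Fin d) ℝ) = 0 := by ext; simp [polyFun]
    simp only [h0, Pi.zero_apply, zero_mul, integral_zero] at key
    have hba : (b : ℝ) - a ≠ 0 := sub_ne_zero.2 (by exact_mod_cast hab.symm)
    have := (mul_eq_zero.1 key.symm).resolve_left (by norm_num)
    exact (mul_eq_zero.1 this).resolve_left hba
  · exact fun i _ => integrable_of_profile (((hi _).mul (by fun_prop)).const_mul _)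
      fun x hx => by simp [profile_eq_zero hx]
  · exact fun i _ => integrable_of_profile ((hi _).mul (by fun_prop))
      fun x hx => by simp [profile_eq_zero hx]

/-- Polar coordinates for a homogeneous polynomial times a radial function. -/
lemma integral_polyFun_mul_norm (hd : 1 ≤ d) {n : ℕ} {p : MvPolynomial (Fin d) ℝ}
    (hp : p.IsHomogeneous n) (g : ℝ → ℝ) :
    ∫ x, polyFun p x * g ‖x‖ =
      (∫ s, polyFun p (s : EuclideanSpace ℝ (Fin d)) ∂(surf d)) *
        ∫ r : Set.Ioi (0 : ℝ), (r : ℝ) ^ n * g r ∂(Measure.volumeIoiPow (d - 1)) := by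
  have : Nonempty (Fin d) := ⟨⟨0, hd⟩⟩
  have : Nontrivial (EuclideanSpace ℝ (Fin d)) := inferInstance
  calc
    ∫ x, polyFun p x * g ‖x‖ =
        ∫ x : (({0}ᶜ : Set (EuclideanSpace ℝ (Fin d))) : Type), polyFun p x.1 * g ‖x.1‖
          ∂(volume.comap Subtype.val) := by
      rw [integral_subtype_comap (measurableSet_singleton _).compl
        fun x => polyFun p x * g ‖x‖, restrict_compl_singleton]
    _ = ∫ z, polyFun p (z.1 : EuclideanSpace ℝ (Fin d)) * ((z.2 : ℝ) ^ n * g z.2)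
          ∂((surf d).prod (.volumeIoiPow (d - 1))) := by
      have h := (volume : Measure (EuclideanSpace ℝ (Fin d))).measurePreserving_homeomorphUnitSphereProd.integral_comp
        (Homeomorph.measurableEmbedding _)
        (fun z => polyFun p (z.1 : EuclideanSpace ℝ (Fin d)) * ((z.2 : ℝ) ^ n * g z.2))
      rw [finrank_euclideanSpace, Fintype.card_fin] at h
      rw [surf, ← h]
      congr 1
      ext x
      have hx : ‖x.1‖ ≠ 0 := norm_ne_zero_iff.2 x.2
      simp only [homeomorphUnitSphereProd_apply_fst_coe, homeomorphUnitSphereProd_apply_snd_coe]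
      rw [polyFun_smul hp, inv_pow]
      field_simp
    _ = _ := integral_prod_mul (μ := surf d) (ν := Measure.volumeIoiPow (d - 1))
      (fun s => polyFun p (s : EuclideanSpace ℝ (Fin d))) (fun r => (r : ℝ) ^ n * g r)

/-- Spherical harmonics of different degrees are orthogonal on the sphere. -/
theorem integral_harmonic_mul_eq_zero (hd : 1 ≤ d) {a b : ℕ} (hab : a ≠ b)
    {p q : MvPolynomial (Fin d) ℝ} (hp : p.IsHomogeneous a) (hq : q.IsHomogeneous b)
    (hp0 : polyLaplacian p = 0) (hq0 : polyLaplacian q = 0) :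
    ∫ s, polyFun p (s : EuclideanSpace ℝ (Fin d)) * polyFun q (s : EuclideanSpace ℝ (Fin d))
      ∂(surf d) = 0 := by
  have h1 := integral_polyFun_mul_norm hd (hp.mul hq) profile
  rw [integral_harmonic_mul_profile_eq_zero hab hp hq hp0 hq0] at h1
  simp only [polyFun_mul] at h1
  refine (mul_eq_zero.1 h1.symm).resolve_right fun h2 => ?_
  -- The constant polynomial 1 with radial part r^(a+b)(1-r²)₊ produces the same radial factor; were
  -- it zero, the integral of a nonnegative, nonzero continuous function would vanish.
  have h3 := integral_polyFun_mul_norm (d := d) hd (MvPolynomial.isHomogeneous_C (Fin d) (1 : ℝ))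
    fun r => r ^ (a + b) * profile r
  simp only [polyFun_C, one_mul, pow_zero] at h3
  rw [h2, mul_zero] at h3
  have : Nonempty (Fin d) := ⟨⟨0, hd⟩⟩
  have hc := continuous_profile
  have hpos : 0 < ∫ x : EuclideanSpace ℝ (Fin d), ‖x‖ ^ (a + b) * profile ‖x‖ := by
    refine Continuous.integral_pos_of_hasCompactSupport_nonneg_nonzero
      (x := EuclideanSpace.single ⟨0, hd⟩ (1 / 2)) (by fun_prop) ?_ ?_ ?_
    · refine HasCompactSupport.intro
        (isCompact_closedBall (0 : EuclideanSpace ℝ (Fin d)) 1) fun x hx => ?_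
      rw [profile_eq_zero, mul_zero]
      simpa using (not_le.1 (by simpa using hx)).le
    · exact fun x => mul_nonneg (by positivity) (profile_nonneg _)
    · have := profile_pos (r := 1 / 2) (by norm_num) (by norm_num)
      simp only [PiLp.norm_single]
      norm_num at this ⊢
      exact this.ne'
  exact hpos.ne' h3

end Orthogonality

/-! ### Decomposition of polynomials on the sphere into harmonics -/

section Decomposition

variable {d : ℕ}

/-- The squared norm, as a polynomial. -/
noncomputable def normSqPoly (d : ℕ) : MvPolynomial (Fin d) ℝ := ∑ i, MvPolynomial.X i ^ 2

lemma isHomogeneous_normSqPoly : (normSqPoly d).IsHomogeneous 2 :=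
  MvPolynomial.IsHomogeneous.sum _ _ _ fun i _ => MvPolynomial.isHomogeneous_X_pow i 2

lemma polyFun_normSqPoly (s : Sph d) : polyFun (normSqPoly d) s = 1 := by
  have := EuclideanSpace.norm_sq_eq (s : EuclideanSpace ℝ (Fin d))
  simp only [norm_eq_of_mem_sphere, one_pow, Real.norm_eq_abs, sq_abs] at this
  rw [normSqPoly, polyFun_sum]
  simpa [polyFun] using this.symm

/-- The Laplacian as a linear map. -/
noncomputable def laplacianHom (d : ℕ) :
    MvPolynomial (Fin d) ℝ →ₗ[ℝ] MvPolynomial (Fin d) ℝ :=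
  ∑ i, (MvPolynomial.pderiv i).toLinearMap ∘ₗ (MvPolynomial.pderiv i).toLinearMap

lemma laplacianHom_apply (p : MvPolynomial (Fin d) ℝ) : laplacianHom d p = polyLaplacian p := by
  simp [laplacianHom, polyLaplacian]

lemma isHomogeneous_polyLaplacian {n : ℕ} {p : MvPolynomial (Fin d) ℝ} (hp : p.IsHomogeneous n) :
    (polyLaplacian p).IsHomogeneous (n - 2) :=
  MvPolynomial.IsHomogeneous.sum _ _ _ fun _ _ => hp.pderiv.pderiv

lemma polyLaplacian_eq_zero_of_lt_two {n : ℕ} (hn : n < 2) {p : MvPolynomial (Fin d) ℝ}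
    (hp : p.IsHomogeneous n) : polyLaplacian p = 0 := by
  refine Finset.sum_eq_zero fun i _ => ?_
  have h : (MvPolynomial.pderiv i p).IsHomogeneous 0 := by
    have := hp.pderiv (i := i)
    rwa [show n - 1 = 0 by omega] at this
  rw [← MvPolynomial.totalDegree_zero_iff_isHomogeneous] at h
  rw [MvPolynomial.totalDegree_eq_zero_iff_eq_C.1 h, MvPolynomial.pderiv_C]

/-- The span of all spherical harmonics. -/
noncomputable def harmonicSpan (d : ℕ) : Submodule ℝ (Sph d → ℝ) := ⨆ ℓ, harmonicSpace d ℓ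

lemma eq_zero_of_forall_sphere {n : ℕ} {p : MvPolynomial (Fin d) ℝ}
    (hd : 1 ≤ d) (hp : p.IsHomogeneous n) (h : ∀ s : Sph d, polyFun p s = 0) : p = 0 := by
  have : Nonempty (Fin d) := ⟨⟨0, hd⟩⟩
  refine eq_zero_of_polyFun_eq_zero fun x => ?_
  by_cases hx : x = 0
  · obtain ⟨s⟩ : Nonempty (Sph d) := (NormedSpace.sphere_nonempty.2 zero_le_one).to_subtype
    -- Scaling by 0 gives p(0) = 0^n p(s), which also covers n = 0.
    have h0 := polyFun_smul hp 0 (s : EuclideanSpace ℝ (Fin d))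
    rw [h, mul_zero, zero_smul] at h0
    rwa [hx]
  · have hx' : ‖x‖ ≠ 0 := norm_ne_zero_iff.2 hx
    have h0 := polyFun_smul hp ‖x‖ (‖x‖⁻¹ • x)
    rw [smul_smul, mul_inv_cancel₀ hx', one_smul] at h0
    rw [h0, h ⟨‖x‖⁻¹ • x, by simp [norm_smul, hx']⟩, mul_zero]

/-- The restriction of a homogeneous polynomial to the sphere is a sum of spherical harmonics of
at most its degree. -/
theorem polyFun_mem_iSup_harmonicSpace (hd : 1 ≤ d) (n : ℕ) (p : MvPolynomial (Fin d) ℝ)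
    (hp : p.IsHomogeneous n) :
    (fun s : Sph d => polyFun p s) ∈ ⨆ ℓ : Fin (n + 1), harmonicSpace d ℓ := by
  induction n using Nat.strong_induction_on generalizing p with
  | _ n ih =>
  have hharm : ∀ q : MvPolynomial (Fin d) ℝ, q.IsHomogeneous n → polyLaplacian q = 0 →
      (fun s : Sph d => polyFun q s) ∈ ⨆ ℓ : Fin (n + 1), harmonicSpace d ℓ := fun q hq hq0 =>
    Submodule.mem_iSup_of_mem (Fin.last n) ⟨q, hq, hq0, fun x => rfl⟩
  rcases lt_or_ge n 2 with hn | hn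
  · exact hharm p hp (polyLaplacian_eq_zero_of_lt_two hn hp)
  obtain ⟨k, rfl⟩ : ∃ k, n = k + 2 := ⟨n - 2, by omega⟩
  let H := MvPolynomial.homogeneousSubmodule (Fin d) ℝ k
  have hmul : ∀ q ∈ H, (normSqPoly d * q).IsHomogeneous (k + 2) := fun q hq => by
    have := isHomogeneous_normSqPoly.mul hq
    rwa [add_comm] at this
  let L : H →ₗ[ℝ] H :=
    (laplacianHom d ∘ₗ LinearMap.mulLeft ℝ (normSqPoly d)).restrict fun q hq => by
      simp only [LinearMap.comp_apply, LinearMap.mulLeft_apply, laplacianHom_apply]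
      exact isHomogeneous_polyLaplacian (hmul q hq)
  have hfin : FiniteDimensional ℝ H :=
    Module.Finite.iff_fg.2 (MvPolynomial.homogeneousSubmodule_fg (Fin d) ℝ k)
  -- If |x|²q is harmonic, it has degree k + 2 and is orthogonal to all harmonics of degree at most
  -- k. By induction q restricted to the sphere is a sum of those, and |x|² = 1 there, so ∫ q² = 0.
  -- The degree bound in the induction hypothesis is essential here.
  have hinj : Function.Injective L := by
    rw [← LinearMap.ker_eq_bot, LinearMap.ker_eq_bot']
    rintro ⟨q, hq⟩ hL
    have hL0 : polyLaplacian (normSqPoly d * q) = 0 := by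
      have := congrArg Subtype.val hL
      simpa [L, laplacianHom_apply] using this
    have hq' := ih k (by omega) q hq
    have horth : ∀ f ∈ ⨆ ℓ : Fin (k + 1), harmonicSpace d ℓ,
        Continuous f ∧ ∫ s : Sph d, polyFun q s * f s ∂(surf d) = 0 := by
      intro f hf
      have hqc : Continuous fun s : Sph d => polyFun q s :=
        (continuous_polyFun q).comp continuous_subtype_val
      refine Submodule.iSup_induction _ (motive := fun f => Continuous f ∧
        ∫ s : Sph d, polyFun q s * f s ∂(surf d) = 0) hf ?_ ?_ ?_
      · rintro ℓ f ⟨r, hr, hr0, hf⟩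
        obtain rfl : f = fun s : Sph d => polyFun r s := funext hf
        refine ⟨(continuous_polyFun r).comp continuous_subtype_val, ?_⟩
        have := integral_harmonic_mul_eq_zero hd (by have := ℓ.2; omega) (hmul q hq) hr hL0 hr0
        simpa [polyFun_normSqPoly] using this
      · exact ⟨continuous_const, by simp⟩
      · rintro f g ⟨hf, hf0⟩ ⟨hg, hg0⟩
        refine ⟨hf.add hg, ?_⟩
        simp only [Pi.add_apply, mul_add]
        rw [integral_add, hf0, hg0, add_zero]
        · exact (hqc.mul hf).integrable_of_hasCompactSupport (HasCompactSupport.of_compactSpace _)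
        · exact (hqc.mul hg).integrable_of_hasCompactSupport (HasCompactSupport.of_compactSpace _)
    obtain ⟨hqc, h0⟩ := horth _ hq'
    have : (surf d).IsOpenPosMeasure := by unfold surf; infer_instance
    have hzero := (integral_eq_zero_iff_of_nonneg (fun s => mul_self_nonneg _)
      ((hqc.mul hqc).integrable_of_hasCompactSupport (HasCompactSupport.of_compactSpace _))).1 h0
    have hzero := (hqc.mul hqc).ae_eq_iff_eq (surf d) continuous_const |>.1 hzero
    exact Subtype.ext (eq_zero_of_forall_sphere hd hq fun s => mul_self_eq_zero.1 (congrFun hzero s))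
  -- In finite dimension L is also onto, so some q makes p - |x|²q harmonic; on the sphere p is this
  -- harmonic plus q, which has lower degree.
  obtain ⟨⟨q, hq⟩, hLq⟩ := (LinearMap.injective_iff_surjective.1 hinj)
    ⟨polyLaplacian p, isHomogeneous_polyLaplacian hp⟩
  have hLq' : polyLaplacian (normSqPoly d * q) = polyLaplacian p := by
    have := congrArg Subtype.val hLq
    simpa [L, laplacianHom_apply] using this
  have h1 := hharm (p - normSqPoly d * q) (hp.sub (hmul q hq)) (by
    rw [← laplacianHom_apply, map_sub, laplacianHom_apply, laplacianHom_apply, hLq', sub_self])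
  have h2 : (fun s : Sph d => polyFun q s) ∈ ⨆ ℓ : Fin (k + 2 + 1), harmonicSpace d ℓ := by
    refine (iSup_le fun ℓ => ?_ : (⨆ ℓ : Fin (k + 1), harmonicSpace d ℓ) ≤ _) (ih k (by omega) q hq)
    exact le_iSup (fun ℓ : Fin (k + 2 + 1) => harmonicSpace d ℓ) ⟨ℓ, by omega⟩
  convert add_mem h1 h2 using 1
  ext s
  simp [polyFun_normSqPoly]

/-- The restriction of a polynomial to the sphere is a sum of spherical harmonics. -/
theorem polyFun_mem_harmonicSpan (hd : 1 ≤ d) (p : MvPolynomial (Fin d) ℝ) :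
    (fun s : Sph d => polyFun p s) ∈ harmonicSpan d := by
  have h : (fun s : Sph d => polyFun p s) = ∑ n ∈ Finset.range (p.totalDegree + 1),
      fun s : Sph d => polyFun (MvPolynomial.homogeneousComponent n p) s := by
    ext s
    rw [Finset.sum_apply, ← polyFun_sum, MvPolynomial.sum_homogeneousComponent]
  rw [h]
  refine sum_mem fun n _ => ?_
  refine (iSup_le fun ℓ => ?_ : (⨆ ℓ : Fin (n + 1), harmonicSpace d ℓ) ≤ harmonicSpan d)
    (polyFun_mem_iSup_harmonicSpace hd n _ (MvPolynomial.homogeneousComponent_isHomogeneous n p))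
  exact le_iSup (harmonicSpace d) ℓ

end Decomposition

/-! ### The Hilbert basis of spherical harmonics and Parseval's identity -/

section Completeness

variable {d : ℕ}

/-- The index set of the spherical harmonics. -/
abbrev HarmIdx (d : ℕ) : Type := Σ ℓ : ℕ, Fin (harmDim ℓ d)

/-- The indices of degree at most `κ`. -/
def lowDeg (d κ : ℕ) : Finset (HarmIdx d) := (Finset.range (κ + 1)).sigma fun _ => Finset.univ

@[simp] lemma mem_lowDeg {κ : ℕ} {i : HarmIdx d} : i ∈ lowDeg d κ ↔ i.1 ≤ κ := by
  simp [lowDeg]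

lemma tendsto_lowDeg : Tendsto (lowDeg d) atTop atTop := by
  refine tendsto_atTop_finset_of_monotone (fun κ κ' h i hi => ?_) fun i => ⟨i.1, by simp⟩
  rw [mem_lowDeg] at hi ⊢
  exact hi.trans h

variable {S : (ℓ : ℕ) → Fin (harmDim ℓ d) → Sph d → ℝ}

lemma IsSphericalHarmonics.exists_poly (hS : IsSphericalHarmonics d S) (ℓ : ℕ)
    (m : Fin (harmDim ℓ d)) : ∃ p : MvPolynomial (Fin d) ℝ, p.IsHomogeneous ℓ ∧
      polyLaplacian p = 0 ∧ S ℓ m = fun s : Sph d => polyFun p s := by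
  have : S ℓ m ∈ harmonicSpace d ℓ := by
    rw [← hS.span_eq]; exact Submodule.subset_span ⟨m, rfl⟩
  obtain ⟨p, hp, hp0, h⟩ := this
  exact ⟨p, hp, hp0, funext h⟩

lemma IsSphericalHarmonics.continuous (hS : IsSphericalHarmonics d S) (ℓ : ℕ)
    (m : Fin (harmDim ℓ d)) : Continuous (S ℓ m) := by
  obtain ⟨p, -, -, h⟩ := hS.exists_poly ℓ m
  rw [h]
  exact (continuous_polyFun p).comp continuous_subtype_val

lemma IsSphericalHarmonics.integral_mul (hS : IsSphericalHarmonics d S) (hd : 1 ≤ d)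
    (i j : HarmIdx d) :
    ∫ x, S i.1 i.2 x * S j.1 j.2 x ∂(surf d) = if i = j then 1 else 0 := by
  obtain ⟨ℓ, m⟩ := i
  obtain ⟨ℓ', m'⟩ := j
  by_cases h : ℓ = ℓ'
  · subst h
    simp [hS.orthonormal]
  · obtain ⟨p, hp, hp0, hpS⟩ := hS.exists_poly ℓ m
    obtain ⟨q, hq, hq0, hqS⟩ := hS.exists_poly ℓ' m'
    simp only [hpS, hqS]
    rw [integral_harmonic_mul_eq_zero hd h hp hq hp0 hq0, if_neg]
    exact fun h' => h (congrArg Sigma.fst h')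

/-- Spherical harmonics as elements of `L²`. -/
noncomputable def harmLp (hS : IsSphericalHarmonics d S) (i : HarmIdx d) : Lp ℝ 2 (surf d) :=
  ContinuousMap.toLp 2 (surf d) ℝ ⟨S i.1 i.2, hS.continuous i.1 i.2⟩

lemma harmLp_ae_eq (hS : IsSphericalHarmonics d S) (i : HarmIdx d) :
    harmLp hS i =ᵐ[surf d] S i.1 i.2 :=
  ContinuousMap.coeFn_toLp (𝕜 := ℝ) (surf d) _

lemma inner_harmLp (hS : IsSphericalHarmonics d S) (i : HarmIdx d) {f : Sph d → ℝ}
    (hf : MemLp f 2 (surf d)) :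
    inner ℝ (harmLp hS i) hf.toLp = ∫ x, f x * S i.1 i.2 x ∂(surf d) := by
  rw [L2.inner_def]
  refine integral_congr_ae ?_
  filter_upwards [harmLp_ae_eq hS i, hf.coeFn_toLp] with x hx hx'
  rw [hx, hx']
  simp

lemma orthonormal_harmLp (hS : IsSphericalHarmonics d S) (hd : 1 ≤ d) :
    Orthonormal ℝ (harmLp hS) := by
  rw [orthonormal_iff_ite]
  intro i j
  rw [L2.inner_def, ← hS.integral_mul hd]
  refine integral_congr_ae ?_
  filter_upwards [harmLp_ae_eq hS i, harmLp_ae_eq hS j] with x hx hx'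
  rw [hx, hx']
  simp [mul_comm]

/-- Continuity is carried through the induction because the embedding into L² is only available for
continuous functions. -/
lemma toLp_mem_span_of_mem_harmonicSpan (hS : IsSphericalHarmonics d S) {f : Sph d → ℝ}
    (hf : f ∈ harmonicSpan d) : ∃ hc : Continuous f,
      ContinuousMap.toLp 2 (surf d) ℝ ⟨f, hc⟩ ∈ Submodule.span ℝ (Set.range (harmLp hS)) := by
  refine Submodule.iSup_induction _ (motive := fun f => ∃ hc : Continuous f,
      ContinuousMap.toLp 2 (surf d) ℝ ⟨f, hc⟩ ∈ Submodule.span ℝ (Set.range (harmLp hS))) hf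
    ?_ ?_ ?_
  · intro ℓ f hf
    rw [← hS.span_eq] at hf
    induction hf using Submodule.span_induction with
    | mem f hf =>
      obtain ⟨m, rfl⟩ := hf
      exact ⟨hS.continuous ℓ m, Submodule.subset_span ⟨⟨ℓ, m⟩, rfl⟩⟩
    | zero => exact ⟨continuous_const, by
        convert Submodule.zero_mem _
        exact map_zero (ContinuousMap.toLp 2 (surf d) ℝ)⟩
    | add f g _ _ hf hg =>
      obtain ⟨hf, hf'⟩ := hf
      obtain ⟨hg, hg'⟩ := hg
      exact ⟨hf.add hg, by
        convert add_mem hf' hg'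
        exact map_add (ContinuousMap.toLp 2 (surf d) ℝ) (⟨f, hf⟩ : C(Sph d, ℝ)) ⟨g, hg⟩⟩
    | smul c f _ hf =>
      obtain ⟨hf, hf'⟩ := hf
      exact ⟨hf.const_smul c, by
        convert Submodule.smul_mem _ c hf'
        exact map_smul (ContinuousMap.toLp 2 (surf d) ℝ) c (⟨f, hf⟩ : C(Sph d, ℝ))⟩
  · exact ⟨continuous_const, by
      convert Submodule.zero_mem _
      exact map_zero (ContinuousMap.toLp 2 (surf d) ℝ)⟩
  · rintro f g ⟨hf, hf'⟩ ⟨hg, hg'⟩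
    exact ⟨hf.add hg, by
      convert add_mem hf' hg'
      exact map_add (ContinuousMap.toLp 2 (surf d) ℝ) (⟨f, hf⟩ : C(Sph d, ℝ)) ⟨g, hg⟩⟩

/-- The algebra homomorphism restricting polynomials to the sphere. -/
noncomputable def polyRestrict (d : ℕ) : MvPolynomial (Fin d) ℝ →ₐ[ℝ] C(Sph d, ℝ) :=
  MvPolynomial.aeval fun i => ⟨fun s => (s : EuclideanSpace ℝ (Fin d)) i, by fun_prop⟩

lemma polyRestrict_apply (p : MvPolynomial (Fin d) ℝ) (s : Sph d) :
    polyRestrict d p s = polyFun p s := by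
  induction p using MvPolynomial.induction_on with
  | C a => simp [polyRestrict]
  | add p q hp hq => simp [hp, hq]
  | mul_X p i hp => simp only [map_mul, ContinuousMap.mul_apply, hp, polyFun_mul]; simp [polyRestrict]

/-- Stone–Weierstrass: the coordinate functions already separate points. -/
lemma dense_range_polyRestrict : DenseRange (polyRestrict d) := by
  have h := ContinuousMap.subalgebra_topologicalClosure_eq_top_of_separatesPoints
    (polyRestrict d).range (by
      intro x y hxy
      obtain ⟨i, hi⟩ : ∃ i, (x : EuclideanSpace ℝ (Fin d)) i ≠ (y : EuclideanSpace ℝ (Fin d)) i := by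
        by_contra! h
        exact hxy (Subtype.ext (PiLp.ext h))
      refine ⟨_, ⟨polyRestrict d (MvPolynomial.X i), ⟨_, rfl⟩, rfl⟩, ?_⟩
      simpa [polyRestrict_apply] using hi)
  have h' := congrArg (fun A : Subalgebra ℝ C(Sph d, ℝ) => (A : Set C(Sph d, ℝ))) h
  rw [DenseRange, dense_iff_closure_eq]
  simpa using h'

/-- Polynomials are uniformly dense in the continuous functions, these are dense in L², and every
restricted polynomial is a combination of harmonics. -/
lemma span_harmLp_dense (hS : IsSphericalHarmonics d S) (hd : 1 ≤ d) :
    ⊤ ≤ (Submodule.span ℝ (Set.range (harmLp hS))).topologicalClosure := by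
  have h1 : DenseRange (fun p => ContinuousMap.toLp 2 (surf d) ℝ (polyRestrict d p)) :=
    (ContinuousMap.toLp_denseRange ℝ (surf d) ℝ (by norm_num)).comp dense_range_polyRestrict
      (ContinuousMap.toLp 2 (surf d) ℝ).continuous
  have h2 : Set.range (fun p => ContinuousMap.toLp 2 (surf d) ℝ (polyRestrict d p)) ⊆
      Submodule.span ℝ (Set.range (harmLp hS)) := by
    rintro _ ⟨p, rfl⟩
    obtain ⟨hc, h⟩ := toLp_mem_span_of_mem_harmonicSpan hS (polyFun_mem_harmonicSpan hd p)
    have hp : polyRestrict d p = ⟨_, hc⟩ := ContinuousMap.ext (polyRestrict_apply p)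
    rwa [← hp] at h
  intro f _
  exact (h1.mono h2) f

/-- The Hilbert basis of `L²` of the sphere consisting of spherical harmonics. -/
noncomputable def harmBasis (hS : IsSphericalHarmonics d S) (hd : 1 ≤ d) :
    HilbertBasis (HarmIdx d) ℝ (Lp ℝ 2 (surf d)) :=
  HilbertBasis.mk (orthonormal_harmLp hS hd) (span_harmLp_dense hS hd)

/-- Parseval's identity for the truncation error of the expansion of a square integrable function
in spherical harmonics. -/
theorem eLpNorm_sub_sum_harm_sq (hS : IsSphericalHarmonics d S) (hd : 1 ≤ d) {f : Sph d → ℝ}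
    (hf : MemLp f 2 (surf d)) (s : Finset (HarmIdx d)) :
    eLpNorm (fun x => f x - ∑ i ∈ s, (∫ y, f y * S i.1 i.2 y ∂(surf d)) * S i.1 i.2 x) 2 (surf d) ^ 2 =
      ∑' i : {i // i ∉ s}, ‖∫ y, f y * S i.1.1 i.1.2 y ∂(surf d)‖ₑ ^ 2 := by
  set a : HarmIdx d → ℝ := fun i => ∫ y, f y * S i.1 i.2 y ∂(surf d) with ha
  set b := harmBasis hS hd with hb
  have hbi : ∀ i, b i = harmLp hS i := fun i => by rw [hb, harmBasis, HilbertBasis.coe_mk]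
  set R : Lp ℝ 2 (surf d) := hf.toLp - ∑ i ∈ s, a i • b i with hR
  have hRae : R =ᵐ[surf d] fun x => f x -
      ∑ i ∈ s, (∫ y, f y * S i.1 i.2 y ∂(surf d)) * S i.1 i.2 x := by
    have h1 : ∀ᵐ x ∂(surf d), ∀ i ∈ s, harmLp hS i x = S i.1 i.2 x :=
      (ae_ball_iff s.countable_toSet).2 fun i _ => harmLp_ae_eq hS i
    have h2 : ∀ᵐ x ∂(surf d), ∀ i ∈ s, (a i • b i : Lp ℝ 2 (surf d)) x = a i * b i x :=
      (ae_ball_iff s.countable_toSet).2 fun i _ => Lp.coeFn_smul (a i) (b i)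
    filter_upwards [Lp.coeFn_sub hf.toLp (∑ i ∈ s, a i • b i),
      Lp.coeFn_finsetSum s fun i => a i • b i, hf.coeFn_toLp, h1, h2]
      with x hx hx1 hx2 hx3 hx4
    rw [hx, Pi.sub_apply, hx1, hx2, Finset.sum_apply]
    congr 1
    refine Finset.sum_congr rfl fun i hi => ?_
    rw [hx4 i hi, hbi, hx3 i hi]
  -- Subtracting the partial sum kills exactly the coefficients in s, so Parseval for the residual R
  -- leaves the sum over the complement.
  have hinner : ∀ i, inner ℝ (b i) R = if i ∈ s then 0 else a i := fun i => by
    rw [hR, inner_sub_right, hbi, inner_harmLp hS i hf, ← hbi, inner_sum]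
    simp only [inner_smul_right, orthonormal_iff_ite.1 b.orthonormal]
    simp only [mul_ite, mul_one, mul_zero, Finset.sum_ite_eq, ha]
    split_ifs <;> simp
  have hsum := b.hasSum_inner_mul_inner R R
  have hsq : ∀ i, inner ℝ R (b i) * inner ℝ (b i) R = (inner ℝ (b i) R) ^ 2 := fun i => by
    rw [real_inner_comm, sq]
  simp only [hsq] at hsum
  rw [← eLpNorm_congr_ae hRae, ← Lp.enorm_def, ← ofReal_norm,
    ← ENNReal.ofReal_pow (norm_nonneg _), ← real_inner_self_eq_norm_sq, ← hsum.tsum_eq,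
    ENNReal.ofReal_tsum_of_nonneg (fun i => sq_nonneg _) hsum.summable]
  refine Eq.trans ?_ (tsum_subtype {i | i ∉ s} fun i => ‖a i‖ₑ ^ 2).symm
  refine tsum_congr fun i => ?_
  rw [hinner]
  by_cases hi : i ∈ s
  · rw [if_pos hi, Set.indicator_of_notMem (by exact fun h => h hi)]
    simp
  · rw [if_neg hi, Set.indicator_of_mem (by exact hi), ← ofReal_norm,
      ← ENNReal.ofReal_pow (norm_nonneg _), Real.norm_eq_abs, sq_abs]

end Completeness

/-! ### Moment comparison for Gaussian variables and their L² limits -/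

section GaussianMoments

/-- A constant in the comparison of the moment of order `2n` of a real Gaussian random variable
with its second moment. -/
noncomputable def gaussConst (n : ℕ) : ℝ≥0∞ :=
  2 ^ (2 * n) * (1 + ∫⁻ x, ‖x‖ₑ ^ (2 * n) ∂(gaussianReal 0 1))

lemma gaussConst_ne_top (n : ℕ) : gaussConst n ≠ ∞ := by
  refine ENNReal.mul_ne_top (by finiteness) (ENNReal.add_ne_top.2 ⟨by simp, ?_⟩)
  have h := (memLp_id_gaussianReal (μ := 0) (v := 1) (2 * n : ℕ)).eLpNorm_lt_top
  rcases Nat.eq_zero_or_pos n with rfl | hn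
  · simp
  · have := lintegral_rpow_enorm_lt_top_of_eLpNorm_lt_top (p := ((2 * n : ℕ) : NNReal))
      (by simp; omega) ENNReal.coe_ne_top h
    simpa [← ENNReal.rpow_natCast] using this.ne

lemma enorm_add_pow_le (a b : ℝ) (k : ℕ) :
    ‖a + b‖ₑ ^ k ≤ 2 ^ k * (‖a‖ₑ ^ k + ‖b‖ₑ ^ k) := by
  calc ‖a + b‖ₑ ^ k ≤ (2 * max ‖a‖ₑ ‖b‖ₑ) ^ k := by
        gcongr
        refine (enorm_add_le a b).trans ?_
        rw [two_mul]
        exact add_le_add (le_max_left _ _) (le_max_right _ _)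
    _ = 2 ^ k * max ‖a‖ₑ ‖b‖ₑ ^ k := mul_pow _ _ _
    _ ≤ _ := by
        gcongr
        rcases le_total ‖a‖ₑ ‖b‖ₑ with h | h
        · rw [max_eq_right h]; exact le_add_self
        · rw [max_eq_left h]; exact le_self_add

lemma lintegral_sq_gaussianReal (m : ℝ) (v : NNReal) :
    ∫⁻ x, ‖x‖ₑ ^ 2 ∂(gaussianReal m v) = ENNReal.ofReal (v + m ^ 2) := by
  have hL : MemLp id 2 (gaussianReal m v) := memLp_id_gaussianReal 2
  have h := variance_eq_sub hL
  rw [variance_id_gaussianReal, show ∫ x, id x ∂(gaussianReal m v) = m from integral_id_gaussianReal] at h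
  have h2 : ∫ x, x ^ 2 ∂(gaussianReal m v) = v + m ^ 2 := by
    have h' : ∫ x, (id ^ 2 : ℝ → ℝ) x ∂(gaussianReal m v) = ∫ x, x ^ 2 ∂(gaussianReal m v) := rfl
    linarith
  rw [← h2, ofReal_integral_eq_lintegral_ofReal (f := fun x : ℝ => x ^ 2) hL.integrable_sq
    (ae_of_all _ fun x => sq_nonneg x)]
  refine lintegral_congr fun x => ?_
  rw [← ofReal_norm, ← ENNReal.ofReal_pow (norm_nonneg _), Real.norm_eq_abs, sq_abs]

/-- Write the variable as √v·x + m with x standard normal: v and m² are both at most the second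
moment v + m². Neither centring nor nondegeneracy is needed. -/
lemma lintegral_pow_gaussianReal_le (m : ℝ) (v : NNReal) (n : ℕ) :
    ∫⁻ x, ‖x‖ₑ ^ (2 * n) ∂(gaussianReal m v) ≤
      gaussConst n * (∫⁻ x, ‖x‖ₑ ^ 2 ∂(gaussianReal m v)) ^ n := by
  have hmap : gaussianReal m v =
      (gaussianReal 0 1).map fun x => Real.sqrt v * x + m := by
    have h1 := gaussianReal_map_const_mul (μ := 0) (v := 1) (Real.sqrt v)
    have h2 := gaussianReal_map_add_const (μ := 0) (v := v) m
    have h3 := Measure.map_map (μ := gaussianReal 0 1) (g := fun x => x + m)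
      (f := fun x => Real.sqrt v * x) (by fun_prop) (by fun_prop)
    refine Eq.trans ?_ h3
    rw [h1]
    have : NNReal.mk (Real.sqrt v ^ 2) (sq_nonneg _) = v :=
      NNReal.eq (Real.sq_sqrt v.2)
    rw [mul_zero, mul_one, this, h2, zero_add]
  set s := ∫⁻ x, ‖x‖ₑ ^ 2 ∂(gaussianReal m v) with hs
  have hs' : s = ENNReal.ofReal (v + m ^ 2) := lintegral_sq_gaussianReal m v
  have hv : ‖Real.sqrt v‖ₑ ^ 2 ≤ s := by
    rw [hs', ← ofReal_norm, ← ENNReal.ofReal_pow (norm_nonneg _), Real.norm_eq_abs, sq_abs,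
      Real.sq_sqrt v.coe_nonneg]
    exact ENNReal.ofReal_le_ofReal (by nlinarith [sq_nonneg m])
  have hm : ‖m‖ₑ ^ 2 ≤ s := by
    rw [hs', ← ofReal_norm, ← ENNReal.ofReal_pow (norm_nonneg _), Real.norm_eq_abs, sq_abs]
    exact ENNReal.ofReal_le_ofReal (by nlinarith [v.2])
  calc ∫⁻ x, ‖x‖ₑ ^ (2 * n) ∂(gaussianReal m v)
      = ∫⁻ x, ‖Real.sqrt v * x + m‖ₑ ^ (2 * n) ∂(gaussianReal 0 1) := by
        rw [hmap, lintegral_map (by fun_prop) (by fun_prop)]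
    _ ≤ ∫⁻ x, 2 ^ (2 * n) * (s ^ n * ‖x‖ₑ ^ (2 * n) + s ^ n) ∂(gaussianReal 0 1) := by
        refine lintegral_mono fun x => (enorm_add_pow_le _ _ _).trans ?_
        refine mul_le_mul_right (add_le_add ?_ ?_) _
        · rw [enorm_mul, mul_pow, pow_mul ‖Real.sqrt v‖ₑ]
          exact mul_le_mul_left (pow_le_pow_left' hv n) _
        · rw [pow_mul]
          exact pow_le_pow_left' hm n
    _ = gaussConst n * s ^ n := by
        rw [lintegral_const_mul _ (by fun_prop), lintegral_add_right _ (by fun_prop),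
          lintegral_const_mul _ (by fun_prop), lintegral_const, measure_univ, gaussConst]
        ring

variable {Ω : Type*} [MeasurableSpace Ω] {P : Measure Ω}

lemma lintegral_pow_le_of_hasGaussianLaw {X : Ω → ℝ} (hX : HasGaussianLaw X P) (n : ℕ) :
    ∫⁻ ω, ‖X ω‖ₑ ^ (2 * n) ∂P ≤ gaussConst n * (∫⁻ ω, ‖X ω‖ₑ ^ 2 ∂P) ^ n := by
  have h := lintegral_pow_gaussianReal_le (P[X]) (Var[X; P]).toNNReal n
  rw [← hX.map_eq_gaussianReal, lintegral_map' (by fun_prop) hX.aemeasurable,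
    lintegral_map' (by fun_prop) hX.aemeasurable] at h
  exact h

lemma lintegral_enorm_sq_eq_enorm_Lp (Z : Lp ℝ 2 P) : ∫⁻ ω, ‖Z ω‖ₑ ^ 2 ∂P = ‖Z‖ₑ ^ 2 := by
  rw [Lp.enorm_def, eLpNorm_eq_lintegral_rpow_enorm_toReal (by norm_num) (by norm_num)]
  simp only [ENNReal.toReal_ofNat, one_div, ENNReal.rpow_ofNat]
  rw [← ENNReal.rpow_natCast, ← ENNReal.rpow_mul]
  norm_num

/-- The comparison of moments persists in the closure in `L²`. -/
lemma isClosed_setOf_lintegral_pow_le (n : ℕ) :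
    IsClosed {Z : Lp ℝ 2 P | ∫⁻ ω, ‖Z ω‖ₑ ^ (2 * n) ∂P ≤
      gaussConst n * (∫⁻ ω, ‖Z ω‖ₑ ^ 2 ∂P) ^ n} := by
  refine IsSeqClosed.isClosed fun Z Z₀ hZ hlim => ?_
  -- Along an almost everywhere convergent subsequence, Fatou's lemma handles the left side and
  -- continuity of the L² norm the right side.
  obtain ⟨ns, hns, hae⟩ := (tendstoInMeasure_of_tendsto_Lp hlim).exists_seq_tendsto_ae
  have hR : Tendsto (fun k => gaussConst n * (∫⁻ ω, ‖Z (ns k) ω‖ₑ ^ 2 ∂P) ^ n) atTop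
      (𝓝 (gaussConst n * (∫⁻ ω, ‖Z₀ ω‖ₑ ^ 2 ∂P) ^ n)) := by
    simp only [lintegral_enorm_sq_eq_enorm_Lp]
    refine ENNReal.Tendsto.const_mul ?_ (Or.inr (gaussConst_ne_top n))
    exact (ENNReal.continuous_pow n).continuousAt.tendsto.comp
      ((ENNReal.continuous_pow 2).continuousAt.tendsto.comp
        ((continuous_enorm.tendsto Z₀).comp (hlim.comp hns.tendsto_atTop)))
  calc ∫⁻ ω, ‖Z₀ ω‖ₑ ^ (2 * n) ∂P
      = ∫⁻ ω, liminf (fun k => ‖Z (ns k) ω‖ₑ ^ (2 * n)) atTop ∂P := by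
        refine lintegral_congr_ae ?_
        filter_upwards [hae] with ω hω
        exact (((ENNReal.continuous_pow (2 * n)).continuousAt.tendsto.comp
          ((continuous_enorm.tendsto _).comp hω)).liminf_eq).symm
    _ ≤ liminf (fun k => ∫⁻ ω, ‖Z (ns k) ω‖ₑ ^ (2 * n) ∂P) atTop :=
        lintegral_liminf_le' fun k =>
          ((Lp.aestronglyMeasurable (Z (ns k))).enorm.pow_const _)
    _ ≤ liminf (fun k => gaussConst n * (∫⁻ ω, ‖Z (ns k) ω‖ₑ ^ 2 ∂P) ^ n) atTop :=
        liminf_le_liminf (Eventually.of_forall fun k => hZ (ns k))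
    _ = _ := hR.liminf_eq

end GaussianMoments

/-! ### Karhunen–Loève coefficients of an isotropic field -/

section Field

variable {d : ℕ} {Ω : Type*} [MeasurableSpace Ω] {P : Measure Ω}
  {T : Sph d → Ω → ℝ} {S : (ℓ : ℕ) → Fin (harmDim ℓ d) → Sph d → ℝ}

namespace IsGaussianIsotropic

lemma memLp (hT : IsGaussianIsotropic T P) (x : Sph d) : MemLp (T x) 2 P :=
  (hT.gaussian.hasGaussianLaw_eval x).memLp_two

lemma measurable_klCoeff (hT : IsGaussianIsotropic T P) (hS : IsSphericalHarmonics d S) (ℓ : ℕ)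
    (m : Fin (harmDim ℓ d)) : Measurable (klCoeff S T ℓ m) := by
  have : Measurable fun z : Ω × Sph d => T z.2 z.1 * S ℓ m z.2 :=
    hT.measurable.mul ((hS.continuous ℓ m).measurable.comp measurable_snd)
  exact (this.stronglyMeasurable.integral_prod_right' (ν := surf d)).measurable

variable [IsProbabilityMeasure P]

/-- The second moment of an isotropic field does not depend on the point of the sphere. -/
lemma exists_lintegral_sq_eq (hT : IsGaussianIsotropic T P) :
    ∃ V : ℝ, ∀ x, ∫⁻ ω, ‖T x ω‖ₑ ^ 2 ∂P = ENNReal.ofReal V := by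
  obtain ⟨μ, hμ⟩ := hT.mean_const
  obtain ⟨k, hk⟩ := hT.cov_isotropic
  -- Variance plus squared mean; `arccos 1` is the distance from a point to itself.
  refine ⟨k (Real.arccos 1) + μ ^ 2, fun x => ?_⟩
  have h1 := variance_eq_sub (hT.memLp x)
  have h2 := hk x x
  rw [covariance_self (hT.memLp x).aemeasurable, real_inner_self_eq_norm_sq,
    norm_eq_of_mem_sphere, one_pow, h1, hμ] at h2
  have h3 : ∫ ω, T x ω ^ 2 ∂P = k (Real.arccos 1) + μ ^ 2 := by
    have : P[T x ^ 2] = ∫ ω, T x ω ^ 2 ∂P := rfl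
    linarith
  rw [← h3, ofReal_integral_eq_lintegral_ofReal (hT.memLp x).integrable_sq
    (ae_of_all _ fun x => sq_nonneg _)]
  refine lintegral_congr fun x => ?_
  rw [← ofReal_norm, ← ENNReal.ofReal_pow (norm_nonneg _), Real.norm_eq_abs, sq_abs]

lemma lintegral_lintegral_sq_lt_top (hT : IsGaussianIsotropic T P) :
    ∫⁻ ω, ∫⁻ x, ‖T x ω‖ₑ ^ 2 ∂(surf d) ∂P < ∞ := by
  obtain ⟨V, hV⟩ := hT.exists_lintegral_sq_eq
  rw [lintegral_lintegral_swap ((hT.measurable.enorm.pow_const 2).aemeasurable)]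
  simp only [hV, lintegral_const]
  exact ENNReal.mul_lt_top ENNReal.ofReal_lt_top (measure_lt_top _ _)

lemma memLp_uncurry (hT : IsGaussianIsotropic T P) :
    MemLp (fun z : Ω × Sph d => T z.2 z.1) 2 (P.prod (surf d)) := by
  refine ⟨hT.measurable.aestronglyMeasurable, ?_⟩
  rw [eLpNorm_lt_top_iff_lintegral_rpow_enorm_lt_top (by norm_num) (by norm_num)]
  simp only [ENNReal.toReal_ofNat, ENNReal.rpow_ofNat]
  rw [lintegral_prod _ (hT.measurable.enorm.pow_const 2).aemeasurable]
  exact hT.lintegral_lintegral_sq_lt_top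

lemma ae_memLp (hT : IsGaussianIsotropic T P) :
    ∀ᵐ ω ∂P, MemLp (fun x => T x ω) 2 (surf d) := by
  have hm : Measurable fun ω => ∫⁻ x, ‖T x ω‖ₑ ^ 2 ∂(surf d) :=
    (hT.measurable.enorm.pow_const 2).lintegral_prod_right'
  filter_upwards [ae_lt_top hm hT.lintegral_lintegral_sq_lt_top.ne] with ω hω
  refine ⟨(hT.measurable.comp (measurable_const.prodMk measurable_id)).aestronglyMeasurable, ?_⟩
  rw [eLpNorm_lt_top_iff_lintegral_rpow_enorm_lt_top (by norm_num) (by norm_num)]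
  simpa using hω

/-- Cauchy–Schwarz with ‖S_{ℓm}‖ = 1; it serves to put the coefficients in L²(Ω). -/
lemma enorm_klCoeff_sq_le (hT : IsGaussianIsotropic T P) (hS : IsSphericalHarmonics d S)
    (hd : 1 ≤ d) (i : HarmIdx d) :
    ∀ᵐ ω ∂P, ‖klCoeff S T i.1 i.2 ω‖ₑ ^ 2 ≤ ∫⁻ x, ‖T x ω‖ₑ ^ 2 ∂(surf d) := by
  filter_upwards [hT.ae_memLp] with ω hω
  have h1 : ‖klCoeff S T i.1 i.2 ω‖ₑ ≤ ‖hω.toLp‖ₑ := by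
    rw [klCoeff, ← inner_harmLp hS i hω, ← ofReal_norm, ← ofReal_norm]
    refine ENNReal.ofReal_le_ofReal ((norm_inner_le_norm _ _).trans ?_)
    rw [(orthonormal_harmLp hS hd).1, one_mul]
  refine (pow_le_pow_left' h1 2).trans ?_
  rw [← lintegral_enorm_sq_eq_enorm_Lp]
  refine (lintegral_congr_ae ?_).le
  filter_upwards [hω.coeFn_toLp] with x hx
  rw [hx]

lemma memLp_klCoeff (hT : IsGaussianIsotropic T P) (hS : IsSphericalHarmonics d S)
    (hd : 1 ≤ d) (i : HarmIdx d) : MemLp (klCoeff S T i.1 i.2) 2 P := by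
  refine ⟨(hT.measurable_klCoeff hS i.1 i.2).aestronglyMeasurable, ?_⟩
  rw [eLpNorm_lt_top_iff_lintegral_rpow_enorm_lt_top (by norm_num) (by norm_num)]
  simp only [ENNReal.toReal_ofNat, ENNReal.rpow_ofNat]
  exact (lintegral_mono_ae (hT.enorm_klCoeff_sq_le hS hd i)).trans_lt
    hT.lintegral_lintegral_sq_lt_top

/-- Integration of a Karhunen–Loève coefficient against a square integrable random variable. -/
lemma integral_mul_klCoeff (hT : IsGaussianIsotropic T P) (hS : IsSphericalHarmonics d S)
    (ℓ : ℕ) (m : Fin (harmDim ℓ d)) {Y : Ω → ℝ} (hY : MemLp Y 2 P) :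
    ∫ ω, Y ω * klCoeff S T ℓ m ω ∂P = ∫ x, (∫ ω, Y ω * T x ω ∂P) * S ℓ m x ∂(surf d) := by
  have hSL : MemLp (S ℓ m) 2 (surf d) :=
    (hS.continuous ℓ m).memLp_of_hasCompactSupport (HasCompactSupport.of_compactSpace _)
  have hprod : MemLp (fun z : Ω × Sph d => Y z.1 * S ℓ m z.2) 2 (P.prod (surf d)) := by
    refine (memLp_two_iff_integrable_sq (hY.aestronglyMeasurable.comp_fst.mul
      hSL.aestronglyMeasurable.comp_snd)).2 ?_
    exact (hY.integrable_sq.mul_prod hSL.integrable_sq).congr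
      (ae_of_all _ fun z => by simp [mul_pow])
  -- Both Y ⊗ S_{ℓm} and T are square integrable on the product, which justifies Fubini.
  have hint : Integrable (fun z : Ω × Sph d => Y z.1 * T z.2 z.1 * S ℓ m z.2)
      (P.prod (surf d)) := by
    refine (hprod.integrable_mul hT.memLp_uncurry).congr (ae_of_all _ fun z => ?_)
    simp only [Pi.mul_apply]
    ring
  calc ∫ ω, Y ω * klCoeff S T ℓ m ω ∂P
      = ∫ ω, ∫ x, Y ω * T x ω * S ℓ m x ∂(surf d) ∂P := by
        simp only [klCoeff, mul_assoc, integral_const_mul]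
    _ = ∫ x, ∫ ω, Y ω * T x ω * S ℓ m x ∂P ∂(surf d) := integral_integral_swap hint
    _ = _ := by simp only [integral_mul_const]

/-- The mean of a Karhunen–Loève coefficient of positive degree vanishes. -/
lemma integral_klCoeff_eq_zero (hT : IsGaussianIsotropic T P) (hS : IsSphericalHarmonics d S)
    (hd : 1 ≤ d) {ℓ : ℕ} (hℓ : ℓ ≠ 0) (m : Fin (harmDim ℓ d)) :
    ∫ ω, klCoeff S T ℓ m ω ∂P = 0 := by
  obtain ⟨μ, hμ⟩ := hT.mean_const
  have h := hT.integral_mul_klCoeff hS ℓ m (memLp_const (1 : ℝ))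
  simp only [one_mul, hμ, integral_const_mul] at h
  obtain ⟨p, hp, hp0, hpS⟩ := hS.exists_poly ℓ m
  -- Constants are harmonics of degree 0, hence orthogonal to S_{ℓm}.
  have h0 := integral_harmonic_mul_eq_zero hd hℓ hp
    (MvPolynomial.isHomogeneous_C (Fin d) (1 : ℝ)) hp0
    (polyLaplacian_eq_zero_of_lt_two two_pos (MvPolynomial.isHomogeneous_C (Fin d) (1 : ℝ)))
  simp only [polyFun_C, mul_one] at h0
  rw [h, hpS, h0, mul_zero]

/-- The second moments of the Karhunen–Loève coefficients of positive degree are given by the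
angular power spectrum. -/
lemma lintegral_klCoeff_sq (hT : IsGaussianIsotropic T P) (hS : IsSphericalHarmonics d S)
    (hd : 1 ≤ d) {A : ℕ → ℝ} (hA : IsAngularPowerSpectrum S T P A) {i : HarmIdx d}
    (hi : i.1 ≠ 0) : ∫⁻ ω, ‖klCoeff S T i.1 i.2 ω‖ₑ ^ 2 ∂P = ENNReal.ofReal (A i.1) := by
  rw [← hA i.1 i.2, ofReal_variance (hT.memLp_klCoeff hS hd i), evariance]
  simp only [hT.integral_klCoeff_eq_zero hS hd hi i.2, sub_zero]

/-- The Karhunen–Loève coefficients satisfy the moment comparison of Gaussian variables. -/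
lemma lintegral_klCoeff_pow_le (hT : IsGaussianIsotropic T P) (hS : IsSphericalHarmonics d S)
    (hd : 1 ≤ d) (i : HarmIdx d) (n : ℕ) :
    ∫⁻ ω, ‖klCoeff S T i.1 i.2 ω‖ₑ ^ (2 * n) ∂P ≤
      gaussConst n * (∫⁻ ω, ‖klCoeff S T i.1 i.2 ω‖ₑ ^ 2 ∂P) ^ n := by
  set K := Submodule.span ℝ (Set.range fun x => (hT.memLp x).toLp) with hK
  have ha := hT.memLp_klCoeff hS hd i
  -- The closure of K is its double orthogonal complement. If Y is orthogonal to every T(x), then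
  -- Fubini gives E(Y a_{ℓm}) = 0, so no approximation of the integral by sums is required.
  have hmem : ha.toLp ∈ K.topologicalClosure := by
    rw [← Submodule.orthogonal_orthogonal_eq_closure, Submodule.mem_orthogonal]
    intro Y hY
    have hYT : ∀ x, ∫ ω, Y ω * T x ω ∂P = 0 := fun x => by
      have h := (Submodule.mem_orthogonal' K Y).1 hY _ (Submodule.subset_span ⟨x, rfl⟩)
      rw [L2.inner_def] at h
      rw [← h]
      refine integral_congr_ae ?_
      filter_upwards [(hT.memLp x).coeFn_toLp] with ω hω
      rw [hω]
      simp [mul_comm]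
    have h := hT.integral_mul_klCoeff hS i.1 i.2 (Lp.memLp Y)
    simp only [hYT, zero_mul, integral_zero] at h
    rw [L2.inner_def, ← h]
    refine integral_congr_ae ?_
    filter_upwards [ha.coeFn_toLp] with ω hω
    rw [hω]
    simp [mul_comm]
  -- Finite linear combinations of values of the field are Gaussian.
  have hsub : (K : Set (Lp ℝ 2 P)) ⊆ {Z : Lp ℝ 2 P | ∫⁻ ω, ‖Z ω‖ₑ ^ (2 * n) ∂P ≤
      gaussConst n * (∫⁻ ω, ‖Z ω‖ₑ ^ 2 ∂P) ^ n} := by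
    intro Z hZ
    obtain ⟨c, rfl⟩ := (Finsupp.mem_span_range_iff_exists_finsupp).1 hZ
    refine lintegral_pow_le_of_hasGaussianLaw ?_ n
    refine ((hT.gaussian.smul c).hasGaussianLaw_fun_sum (I := c.support)).congr ?_
    have h1 : ∀ᵐ ω ∂P, ∀ x ∈ c.support, (hT.memLp x).toLp (T x) ω = T x ω :=
      (ae_ball_iff c.support.countable_toSet).2 fun x _ => (hT.memLp x).coeFn_toLp
    have h2 : ∀ᵐ ω ∂P, ∀ x ∈ c.support,
        (c x • (hT.memLp x).toLp (T x) : Lp ℝ 2 P) ω = c x * (hT.memLp x).toLp (T x) ω :=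
      (ae_ball_iff c.support.countable_toSet).2 fun x _ => Lp.coeFn_smul _ _
    filter_upwards [Lp.coeFn_finsetSum c.support fun x => c x • (hT.memLp x).toLp, h1, h2]
      with ω h h1 h2
    rw [Finsupp.sum, h, Finset.sum_apply]
    refine Finset.sum_congr rfl fun x hx => ?_
    rw [h2 x hx, h1 x hx]
    rfl
  have hfin : ha.toLp ∈ {Z : Lp ℝ 2 P | ∫⁻ ω, ‖Z ω‖ₑ ^ (2 * n) ∂P ≤
      gaussConst n * (∫⁻ ω, ‖Z ω‖ₑ ^ 2 ∂P) ^ n} :=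
    closure_minimal hsub (isClosed_setOf_lintegral_pow_le n) hmem
  have hcongr : ∀ k : ℕ, ∫⁻ ω, ‖ha.toLp (klCoeff S T i.1 i.2) ω‖ₑ ^ k ∂P =
      ∫⁻ ω, ‖klCoeff S T i.1 i.2 ω‖ₑ ^ k ∂P := fun k => by
    refine lintegral_congr_ae ?_
    filter_upwards [ha.coeFn_toLp] with ω hω
    rw [hω]
  rw [Set.mem_ofPred_eq, hcongr, hcongr] at hfin
  exact hfin

end IsGaussianIsotropic

end Field

/-! ### Minkowski's inequality for series -/

section Minkowski

variable {Ω : Type*} [MeasurableSpace Ω] {P : Measure Ω}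

/-- Minkowski's inequality for finite sums of nonnegative functions, in the form of moment
bounds. -/
lemma lintegral_sum_pow_le {ι : Type*} {g : ι → Ω → ℝ≥0∞} (hg : ∀ i, Measurable (g i))
    {e : ι → ℝ≥0∞} {c : ℝ≥0∞} {n : ℕ} (hn : 1 ≤ n)
    (h : ∀ i, ∫⁻ ω, g i ω ^ n ∂P ≤ c * e i ^ n) (s : Finset ι) :
    ∫⁻ ω, (∑ i ∈ s, g i ω) ^ n ∂P ≤ c * (∑ i ∈ s, e i) ^ n := by
  have hn0 : (0 : ℝ) < n := by exact_mod_cast hn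
  have h1 : ∀ f : Ω → ℝ≥0∞, eLpNorm' f n P = (∫⁻ ω, f ω ^ n ∂P) ^ (1 / (n : ℝ)) := fun f => by
    simp [eLpNorm'_eq_lintegral_enorm]
  have h2 := eLpNorm'_sum_le (μ := P) (q := n) (s := s) (f := g)
    (fun i _ => (hg i).aestronglyMeasurable) (by exact_mod_cast hn)
  have h3 : ∀ i, eLpNorm' (g i) n P ≤ c ^ (1 / (n : ℝ)) * e i := fun i => by
    rw [h1]
    refine (ENNReal.rpow_le_rpow (h i) (by positivity)).trans ?_
    rw [ENNReal.mul_rpow_of_nonneg _ _ (by positivity), ← ENNReal.rpow_natCast (e i),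
      ← ENNReal.rpow_mul, mul_one_div_cancel hn0.ne', ENNReal.rpow_one]
  have h4 := h2.trans (Finset.sum_le_sum fun i _ => h3 i)
  rw [h1, ← Finset.mul_sum] at h4
  have h5 := ENNReal.rpow_le_rpow h4 hn0.le
  rw [← ENNReal.rpow_mul, one_div_mul_cancel hn0.ne', ENNReal.rpow_one,
    ENNReal.mul_rpow_of_nonneg _ _ hn0.le, ← ENNReal.rpow_mul, one_div_mul_cancel hn0.ne',
    ENNReal.rpow_one, ENNReal.rpow_natCast] at h5
  simpa using h5

/-- Minkowski's inequality for series of nonnegative functions, in the form of moment bounds. -/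
lemma lintegral_tsum_pow_le {ι : Type*} [Countable ι] {g : ι → Ω → ℝ≥0∞}
    (hg : ∀ i, Measurable (g i)) {e : ι → ℝ≥0∞} {c : ℝ≥0∞} {n : ℕ} (hn : 1 ≤ n)
    (h : ∀ i, ∫⁻ ω, g i ω ^ n ∂P ≤ c * e i ^ n) :
    ∫⁻ ω, (∑' i, g i ω) ^ n ∂P ≤ c * (∑' i, e i) ^ n := by
  have hmono : Monotone fun x : ℝ≥0∞ => x ^ n := fun x y hxy => pow_le_pow_left' hxy n
  have h1 : ∀ ω, (∑' i, g i ω) ^ n = ⨆ s : Finset ι, (∑ i ∈ s, g i ω) ^ n := fun ω => by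
    rw [ENNReal.tsum_eq_iSup_sum]
    exact hmono.map_iSup_of_continuousAt (ENNReal.continuous_pow n).continuousAt
      (by simp; omega)
  simp only [h1]
  -- Monotone convergence over the countable directed family of finite partial sums.
  rw [lintegral_iSup_directed
    (fun s => ((Finset.measurable_fun_sum s fun i _ => hg i).pow_const n).aemeasurable)]
  · refine iSup_le fun s => (lintegral_sum_pow_le hg hn h s).trans ?_
    exact mul_le_mul_right (pow_le_pow_left' (ENNReal.sum_le_tsum s) n) _
  · refine Monotone.directed_le fun s t hst ω => hmono ?_
    exact Finset.sum_le_sum_of_subset hst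

end Minkowski

/-! ### Dimension growth and tails of power series -/

section PowerSums

/-- The dimension of the space of spherical harmonics grows at most like `ℓ ^ (d - 2)`. -/
lemma harmDim_le {d ℓ : ℕ} (hd : 2 ≤ d) (hℓ : 1 ≤ ℓ) : harmDim ℓ d ≤ d * ℓ ^ (d - 2) := by
  obtain ⟨k, rfl⟩ : ∃ k, d = k + 2 := ⟨d - 2, by omega⟩
  rw [harmDim, if_neg (by omega)]
  simp only [Nat.add_sub_cancel]
  -- The quotient is a natural number division; an upper bound needs no divisibility.
  refine Nat.div_le_of_le_mul ?_
  -- Each factor ℓ + j of ℓ(ℓ+1)⋯(ℓ+k-1) is at most (j+1)ℓ.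
  have h1 : (ℓ + (k + 2) - 3).factorial ≤ (ℓ - 1).factorial * (k.factorial * ℓ ^ k) := by
    rw [show ℓ + (k + 2) - 3 = ℓ + k - 1 by omega, ← Nat.factorial_mul_ascFactorial' ℓ k hℓ]
    exact Nat.mul_le_mul_left _ (Nat.ascFactorial_le_factorial_mul_pow ℓ k)
  have h2 : 2 * ℓ + (k + 2) - 2 ≤ (k + 2) * ℓ := by
    have : k ≤ k * ℓ := Nat.le_mul_of_pos_right k hℓ
    rw [add_mul]
    omega
  calc (2 * ℓ + (k + 2) - 2) * (ℓ + (k + 2) - 3).factorial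
      ≤ ((k + 2) * ℓ) * ((ℓ - 1).factorial * (k.factorial * ℓ ^ k)) := Nat.mul_le_mul h2 h1
    _ = k.factorial * (ℓ * (ℓ - 1).factorial) * ((k + 2) * ℓ ^ k) := by ring
    _ = _ := by rw [Nat.mul_factorial_pred (by omega)]

/-- The tail of a convergent power series `∑ ℓ ^ (-(t + 1))`. -/
lemma tsum_rpow_tail_le {t : ℝ} (ht : 0 < t) {κ : ℕ} (hκ : 1 ≤ κ) :
    ∑' ℓ : ℕ, (if κ < ℓ then ENNReal.ofReal ((ℓ : ℝ) ^ (-(t + 1))) else 0) ≤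
      ENNReal.ofReal ((κ : ℝ) ^ (-t) / t) := by
  refine ENNReal.tsum_le_of_sum_range_le fun N => ?_
  rw [← Finset.sum_filter, ← ENNReal.ofReal_sum_of_nonneg fun i _ => by positivity]
  refine ENNReal.ofReal_le_ofReal ?_
  have hκ0 : (0 : ℝ) < κ := by exact_mod_cast hκ
  have hanti : AntitoneOn (fun x : ℝ => x ^ (-(t + 1))) (Set.Icc (κ : ℝ) ((κ + N : ℕ) : ℝ)) :=
    fun x hx y _ hxy =>
      Real.rpow_le_rpow_of_nonpos (hκ0.trans_le hx.1) hxy (by linarith)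
  -- The terms with κ < ℓ ≤ κ + N are bounded by the integral from κ to κ + N, so the bound has
  -- κ^(-t)/t without a shift.
  have h1 := hanti.sum_le_integral_Ico (by omega)
  have h0 : (0 : ℝ) ∉ Set.uIcc (κ : ℝ) ((κ + N : ℕ) : ℝ) := by
    rw [Set.uIcc_of_le (by push_cast; linarith [(Nat.cast_nonneg N : (0 : ℝ) ≤ N)])]
    exact fun h => absurd h.1 (not_le.2 hκ0)
  rw [integral_rpow (Or.inr ⟨by linarith, h0⟩)] at h1
  calc ∑ ℓ ∈ (Finset.range N).filter (κ < ·), (ℓ : ℝ) ^ (-(t + 1))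
      ≤ ∑ ℓ ∈ Finset.Ico (κ + 1) (κ + N + 1), (ℓ : ℝ) ^ (-(t + 1)) := by
        refine Finset.sum_le_sum_of_subset_of_nonneg (fun ℓ hℓ => ?_) fun _ _ _ => by positivity
        simp only [Finset.mem_filter, Finset.mem_range, Finset.mem_Ico] at hℓ ⊢
        omega
    _ = ∑ ℓ ∈ Finset.Ico κ (κ + N), ((ℓ + 1 : ℕ) : ℝ) ^ (-(t + 1)) :=
        (Finset.sum_Ico_add' (fun ℓ : ℕ => (ℓ : ℝ) ^ (-(t + 1))) κ (κ + N) 1).symm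
    _ ≤ _ := h1
    _ ≤ (κ : ℝ) ^ (-t) / t := by
        rw [show -(t + 1) + 1 = -t by ring, div_neg, ← neg_div, neg_sub]
        have : 0 ≤ ((κ + N : ℕ) : ℝ) ^ (-t) := by positivity
        gcongr
        linarith

end PowerSums

/-! ### Truncation error and tail energy -/

section TruncationError

variable {d : ℕ} {Ω : Type*} [MeasurableSpace Ω]

/-- The expected energy of the Karhunen–Loève coefficients of degree larger than `κ`. -/
noncomputable def tailEnergy (S : (ℓ : ℕ) → Fin (harmDim ℓ d) → Sph d → ℝ) (T : Sph d → Ω → ℝ)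
    (P : Measure Ω) (κ : ℕ) : ℝ≥0∞ :=
  ∑' i : {i // i ∉ lowDeg d κ}, ∫⁻ ω, ‖klCoeff S T i.1.1 i.1.2 ω‖ₑ ^ 2 ∂P

/-- The constant comparing the moment of order `p` of the truncation error with its second
moment. -/
noncomputable def momentConst (p : ℝ) : ℝ≥0∞ := gaussConst ⌈p⌉₊ ^ (1 / (2 * ⌈p⌉₊ : ℝ))

lemma momentConst_ne_top (p : ℝ) : momentConst p ≠ ∞ :=
  ENNReal.rpow_ne_top_of_nonneg (by positivity) (gaussConst_ne_top _)

variable {P : Measure Ω} [IsProbabilityMeasure P]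
  {T : Sph d → Ω → ℝ} {S : (ℓ : ℕ) → Fin (harmDim ℓ d) → Sph d → ℝ}

namespace IsGaussianIsotropic

/-- Parseval applied pathwise; one null set serves all κ. -/
lemma ae_truncError_sq (hT : IsGaussianIsotropic T P) (hS : IsSphericalHarmonics d S)
    (hd : 1 ≤ d) : ∀ᵐ ω ∂P, ∀ κ, truncError S T κ ω ^ 2 =
      ∑' i : {i // i ∉ lowDeg d κ}, ‖klCoeff S T i.1.1 i.1.2 ω‖ₑ ^ 2 := by
  filter_upwards [hT.ae_memLp] with ω hω κ
  have h := eLpNorm_sub_sum_harm_sq hS hd hω (lowDeg d κ)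
  simp only [lowDeg, Finset.sum_sigma] at h
  exact h

lemma ae_tsum_klCoeff_sq (hT : IsGaussianIsotropic T P) (hS : IsSphericalHarmonics d S)
    (hd : 1 ≤ d) : ∀ᵐ ω ∂P, ∑' i : HarmIdx d, ‖klCoeff S T i.1 i.2 ω‖ₑ ^ 2 =
      ∫⁻ x, ‖T x ω‖ₑ ^ 2 ∂(surf d) := by
  filter_upwards [hT.ae_memLp] with ω hω
  have h := eLpNorm_sub_sum_harm_sq hS hd hω ∅
  simp only [Finset.sum_empty, sub_zero] at h
  rw [eLpNorm_eq_lintegral_rpow_enorm_toReal (by norm_num) (by norm_num),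
    ← ENNReal.rpow_natCast, ← ENNReal.rpow_mul] at h
  norm_num at h
  rw [h]
  exact ((Equiv.subtypeUnivEquiv fun i : HarmIdx d => Finset.notMem_empty i).tsum_eq
    fun i : HarmIdx d => ‖klCoeff S T i.1 i.2 ω‖ₑ ^ 2).symm

lemma tsum_lintegral_klCoeff_sq_ne_top (hT : IsGaussianIsotropic T P)
    (hS : IsSphericalHarmonics d S) (hd : 1 ≤ d) :
    ∑' i : HarmIdx d, ∫⁻ ω, ‖klCoeff S T i.1 i.2 ω‖ₑ ^ 2 ∂P ≠ ∞ := by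
  rw [← lintegral_tsum fun i : HarmIdx d =>
    ((hT.measurable_klCoeff hS i.1 i.2).enorm.pow_const 2).aemeasurable,
    lintegral_congr_ae (hT.ae_tsum_klCoeff_sq hS hd)]
  exact hT.lintegral_lintegral_sq_lt_top.ne

/-- The total energy is finite by isotropy alone, so its tails vanish without any decay of the
spectrum. -/
lemma tendsto_tailEnergy (hT : IsGaussianIsotropic T P)
    (hS : IsSphericalHarmonics d S) (hd : 1 ≤ d) :
    Tendsto (tailEnergy S T P) atTop (𝓝 0) :=
  (ENNReal.tendsto_tsum_compl_atTop_zero (hT.tsum_lintegral_klCoeff_sq_ne_top hS hd)).comp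
    tendsto_lowDeg

/-- The truncated expansions converge almost surely in `L²` of the sphere. -/
theorem ae_tendsto_truncError (hT : IsGaussianIsotropic T P)
    (hS : IsSphericalHarmonics d S) (hd : 1 ≤ d) :
    ∀ᵐ ω ∂P, Tendsto (fun κ => truncError S T κ ω) atTop (𝓝 0) := by
  have hm : Measurable fun ω => ∫⁻ x, ‖T x ω‖ₑ ^ 2 ∂(surf d) :=
    (hT.measurable.enorm.pow_const 2).lintegral_prod_right'
  filter_upwards [hT.ae_truncError_sq hS hd, hT.ae_tsum_klCoeff_sq hS hd,
    ae_lt_top hm hT.lintegral_lintegral_sq_lt_top.ne] with ω h1 h2 h3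
  have h4 : Tendsto (fun κ => truncError S T κ ω ^ 2) atTop (𝓝 0) := by
    simp only [h1]
    exact (ENNReal.tendsto_tsum_compl_atTop_zero (by rw [h2]; exact h3.ne)).comp tendsto_lowDeg
  have h5 := (ENNReal.continuous_rpow_const (y := 1 / 2)).continuousAt.tendsto.comp h4
  rw [ENNReal.zero_rpow_of_pos (by norm_num)] at h5
  refine h5.congr fun κ => ?_
  rw [Function.comp_apply, ← ENNReal.rpow_natCast, ← ENNReal.rpow_mul]
  norm_num

lemma aemeasurable_truncError (hT : IsGaussianIsotropic T P)
    (hS : IsSphericalHarmonics d S) (hd : 1 ≤ d) (κ : ℕ) :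
    AEMeasurable (truncError S T κ) P := by
  have hi : ∀ i : {i // i ∉ lowDeg d κ}, Measurable fun ω =>
      ‖klCoeff S T i.1.1 i.1.2 ω‖ₑ ^ 2 := fun i =>
    (hT.measurable_klCoeff hS i.1.1 i.1.2).enorm.pow_const 2
  have hs : Measurable fun ω => ∑' i : {i // i ∉ lowDeg d κ}, ‖klCoeff S T i.1.1 i.1.2 ω‖ₑ ^ 2 :=
    Measurable.tsum hi
  have hm := hs.pow_const (1 / 2 : ℝ)
  refine ⟨_, hm, ?_⟩
  filter_upwards [hT.ae_truncError_sq hS hd] with ω h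
  rw [← h, ← ENNReal.rpow_natCast, ← ENNReal.rpow_mul]
  norm_num

/-- The truncation error in `L^p` is controlled by the tail energy. -/
theorem truncErrorLp_le (hT : IsGaussianIsotropic T P)
    (hS : IsSphericalHarmonics d S) (hd : 1 ≤ d) {p : ℝ} (hp : 1 ≤ p) (κ : ℕ) :
    truncErrorLp S T P p κ ≤ momentConst p * tailEnergy S T P κ ^ (1 / 2 : ℝ) := by
  set n := ⌈p⌉₊ with hn
  have hn1 : 1 ≤ n := Nat.one_le_ceil_iff.2 (by linarith)
  have hn0 : (0 : ℝ) < n := by exact_mod_cast hn1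
  have hpn : p ≤ 2 * n := by linarith [Nat.le_ceil p]
  have h1 : ∀ q : ℝ, eLpNorm' (truncError S T κ) q P =
      (∫⁻ ω, truncError S T κ ω ^ q ∂P) ^ (1 / q) := fun q => by
    simp [eLpNorm'_eq_lintegral_enorm]
  -- On a probability space L^p norms increase with p; the even exponent 2n turns the error into the
  -- n-th power of the Parseval sum.
  have h2 : truncErrorLp S T P p κ ≤ (∫⁻ ω, truncError S T κ ω ^ (2 * n : ℝ) ∂P) ^
      (1 / (2 * n : ℝ)) := by
    rw [truncErrorLp, ← h1, ← h1]
    exact eLpNorm'_le_eLpNorm'_of_exponent_le (by linarith) hpn P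
      (hT.aemeasurable_truncError hS hd κ).aestronglyMeasurable
  have h3 : ∫⁻ ω, truncError S T κ ω ^ (2 * n : ℝ) ∂P =
      ∫⁻ ω, (∑' i : {i // i ∉ lowDeg d κ}, ‖klCoeff S T i.1.1 i.1.2 ω‖ₑ ^ 2) ^ n ∂P := by
    refine lintegral_congr_ae ?_
    filter_upwards [hT.ae_truncError_sq hS hd] with ω h
    rw [← h, ← pow_mul, ← ENNReal.rpow_natCast]
    push_cast
    rfl
  have h4 := lintegral_tsum_pow_le (P := P) (c := gaussConst n)
    (g := fun (i : {i // i ∉ lowDeg d κ}) ω => ‖klCoeff S T i.1.1 i.1.2 ω‖ₑ ^ 2)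
    (e := fun i => ∫⁻ ω, ‖klCoeff S T i.1.1 i.1.2 ω‖ₑ ^ 2 ∂P)
    (fun i => (hT.measurable_klCoeff hS i.1.1 i.1.2).enorm.pow_const 2) hn1 (fun i => by
      simp only [← pow_mul]
      exact hT.lintegral_klCoeff_pow_le hS hd i.1 n)
  refine h2.trans ?_
  rw [h3]
  refine (ENNReal.rpow_le_rpow h4 (by positivity)).trans ?_
  rw [ENNReal.mul_rpow_of_nonneg _ _ (by positivity), ← ENNReal.rpow_natCast (∑' _, _),
    ← ENNReal.rpow_mul, momentConst, ← hn, tailEnergy,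
    show (n : ℝ) * (1 / (2 * n)) = 1 / 2 by field_simp]

/-- The tail energy under polynomial decay of the angular power spectrum. -/
theorem tailEnergy_le (hT : IsGaussianIsotropic T P)
    (hS : IsSphericalHarmonics d S) (hd : 2 ≤ d) {A : ℕ → ℝ}
    (hA : IsAngularPowerSpectrum S T P A) {α C : ℝ} (hC : 0 < C) (hα : (d : ℝ) - 1 < α) {ℓ₀ : ℕ}
    (hdecay : ∀ ℓ : ℕ, ℓ₀ < ℓ → A ℓ ≤ C * (ℓ : ℝ) ^ (-α)) {κ : ℕ} (hκ : 1 ≤ κ) (hℓ₀ : ℓ₀ ≤ κ) :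
    tailEnergy S T P κ ≤
      ENNReal.ofReal (d * C / (α + 1 - d) * (κ : ℝ) ^ (-(α + 1 - d))) := by
  set t := α + 1 - d with ht
  have ht0 : 0 < t := by rw [ht]; linarith
  -- The exponents combine as (d - 2) - α = -(t + 1).
  have hterm : ∀ ℓ : ℕ, κ < ℓ → (harmDim ℓ d : ℝ≥0∞) * ENNReal.ofReal (A ℓ) ≤
      ENNReal.ofReal (d * C) * ENNReal.ofReal ((ℓ : ℝ) ^ (-(t + 1))) := fun ℓ hℓ => by
    have hℓ1 : (0 : ℝ) < ℓ := by exact_mod_cast (by omega : 0 < ℓ)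
    have h1 : (harmDim ℓ d : ℝ) ≤ d * (ℓ : ℝ) ^ (d - 2) := by
      exact_mod_cast harmDim_le hd (by omega)
    rw [← ENNReal.ofReal_natCast, ← ENNReal.ofReal_mul (by positivity),
      ← ENNReal.ofReal_mul (by positivity)]
    refine ENNReal.ofReal_le_ofReal ?_
    calc (harmDim ℓ d : ℝ) * A ℓ ≤ harmDim ℓ d * (C * (ℓ : ℝ) ^ (-α)) := by
          gcongr
          exact hdecay ℓ (by omega)
      _ ≤ d * (ℓ : ℝ) ^ (d - 2) * (C * (ℓ : ℝ) ^ (-α)) := by gcongr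
      _ = d * C * ((ℓ : ℝ) ^ (d - 2) * (ℓ : ℝ) ^ (-α)) := by ring
      _ = _ := by
          rw [← Real.rpow_natCast, ← Real.rpow_add hℓ1, Nat.cast_sub hd, ht]
          congr 2
          push_cast
          ring
  calc tailEnergy S T P κ
      = ∑' i : HarmIdx d, (if κ < i.1 then ∫⁻ ω, ‖klCoeff S T i.1 i.2 ω‖ₑ ^ 2 ∂P else 0) := by
        rw [tailEnergy]
        refine (tsum_subtype {i | i ∉ lowDeg d κ}
          fun i => ∫⁻ ω, ‖klCoeff S T i.1 i.2 ω‖ₑ ^ 2 ∂P).trans (tsum_congr fun i => ?_)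
        simp [Set.indicator_apply]
    _ = ∑' ℓ : ℕ, ∑' m : Fin (harmDim ℓ d),
          (if κ < ℓ then ∫⁻ ω, ‖klCoeff S T ℓ m ω‖ₑ ^ 2 ∂P else 0) := ENNReal.tsum_sigma' _
    _ ≤ ∑' ℓ : ℕ, ENNReal.ofReal (d * C) *
          (if κ < ℓ then ENNReal.ofReal ((ℓ : ℝ) ^ (-(t + 1))) else 0) := by
        refine ENNReal.tsum_le_tsum fun ℓ => ?_
        split_ifs with hℓ
        · refine le_trans (le_of_eq ?_) (hterm ℓ hℓ)
          -- As ℓ > κ ≥ 1, the coefficient is centred and its second moment is A_ℓ; in degree 0 the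
          -- mean may contribute.
          rw [tsum_fintype, Finset.sum_congr rfl fun m _ =>
            hT.lintegral_klCoeff_sq hS (by omega) hA (i := ⟨ℓ, m⟩) (by simp; omega)]
          simp
        · simp
    _ ≤ ENNReal.ofReal (d * C) * ENNReal.ofReal ((κ : ℝ) ^ (-t) / t) := by
        rw [ENNReal.tsum_mul_left]
        exact mul_le_mul_right (tsum_rpow_tail_le ht0 hκ) _
    _ = _ := by
        rw [← ENNReal.ofReal_mul (by positivity)]
        congr 1
        ring

end IsGaussianIsotropic

end TruncationError

/-! ### Rates of convergence -/

namespace IsGaussianIsotropic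

variable {d : ℕ} {Ω : Type*} [MeasurableSpace Ω] {P : Measure Ω} [IsProbabilityMeasure P]
  {T : Sph d → Ω → ℝ} {S : (ℓ : ℕ) → Fin (harmDim ℓ d) → Sph d → ℝ}

/-- The rate of convergence in `L^p` with a constant independent of the field. -/
theorem truncErrorLp_le_rpow (hT : IsGaussianIsotropic T P)
    (hS : IsSphericalHarmonics d S) (hd : 2 ≤ d) {A : ℕ → ℝ}
    (hA : IsAngularPowerSpectrum S T P A) {α C : ℝ} (hC : 0 < C) (hα : (d : ℝ) - 1 < α) {ℓ₀ : ℕ}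
    (hdecay : ∀ ℓ : ℕ, ℓ₀ < ℓ → A ℓ ≤ C * (ℓ : ℝ) ^ (-α)) {p : ℝ} (hp : 1 ≤ p)
    {κ : ℕ} (hκ : 1 ≤ κ) (hℓ₀ : ℓ₀ ≤ κ) :
    truncErrorLp S T P p κ ≤ ENNReal.ofReal
      (((momentConst p).toReal * (d * C / (α + 1 - d)) ^ (1 / 2 : ℝ) + 1) *
        (κ : ℝ) ^ (-((α + 1 - d) / 2))) := by
  have ht0 : 0 < α + 1 - d := by linarith
  have hd0 : (0 : ℝ) < d := by exact_mod_cast (by omega : 0 < d)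
  refine (hT.truncErrorLp_le hS (by omega) hp κ).trans ?_
  refine (mul_le_mul_right (ENNReal.rpow_le_rpow
    (hT.tailEnergy_le hS hd hA hC hα hdecay hκ hℓ₀) (by norm_num)) _).trans ?_
  rw [ENNReal.ofReal_rpow_of_nonneg (by positivity) (by norm_num),
    ← ENNReal.ofReal_toReal (momentConst_ne_top p), ← ENNReal.ofReal_mul (by positivity),
    ENNReal.toReal_ofReal (by positivity)]
  refine ENNReal.ofReal_le_ofReal ?_
  rw [Real.mul_rpow (by positivity) (by positivity), ← Real.rpow_mul (by positivity),
    show -(α + 1 - d) * (1 / 2) = -((α + 1 - d) / 2) by ring, ← mul_assoc]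
  -- The extra summand 1 is slack that makes the constant visibly positive.
  gcongr
  linarith

lemma tendsto_truncErrorLp (hT : IsGaussianIsotropic T P)
    (hS : IsSphericalHarmonics d S) (hd : 1 ≤ d) {p : ℝ} (hp : 1 ≤ p) :
    Tendsto (truncErrorLp S T P p) atTop (𝓝 0) := by
  have h := (ENNReal.continuous_rpow_const (y := 1 / 2)).continuousAt.tendsto.comp
    (hT.tendsto_tailEnergy hS hd)
  have h2 := ENNReal.Tendsto.const_mul h (Or.inr (momentConst_ne_top p))
  rw [ENNReal.zero_rpow_of_pos (by norm_num), mul_zero] at h2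
  exact tendsto_of_tendsto_of_tendsto_of_le_of_le tendsto_const_nhds h2 (fun _ => zero_le)
    fun κ => hT.truncErrorLp_le hS hd hp κ

/-- The rate of convergence in `L^p` for a fixed field. -/
theorem exists_truncErrorLp_le_rpow (hT : IsGaussianIsotropic T P)
    (hS : IsSphericalHarmonics d S) (hd : 2 ≤ d) {A : ℕ → ℝ}
    (hA : IsAngularPowerSpectrum S T P A) {α C : ℝ} (hC : 0 < C) {ℓ₀ : ℕ}
    (hdecay : ∀ ℓ : ℕ, ℓ₀ < ℓ → A ℓ ≤ C * (ℓ : ℝ) ^ (-α)) {p : ℝ} (hp : 1 ≤ p) :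
    ∃ K : ℝ, 0 < K ∧ ∀ κ : ℕ, 1 ≤ κ → ℓ₀ ≤ κ → truncErrorLp S T P p κ ≤
      ENNReal.ofReal (K * (κ : ℝ) ^ (-((α + 1 - d) / 2))) := by
  rcases lt_or_ge ((d : ℝ) - 1) α with hα | hα
  · have ht0 : 0 < α + 1 - d := by linarith
    exact ⟨_, by positivity,
      fun κ hκ hℓ₀ => hT.truncErrorLp_le_rpow hS hd hA hC hα hdecay hp hκ hℓ₀⟩
  -- Here α ≤ d - 1, so the power of κ is at least 1 and the bound by the total energy of the field
  -- suffices; this constant depends on T.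
  · set M := momentConst p * (∑' i : HarmIdx d,
      ∫⁻ ω, ‖klCoeff S T i.1 i.2 ω‖ₑ ^ 2 ∂P) ^ (1 / 2 : ℝ) with hM
    have hMtop : M ≠ ∞ := ENNReal.mul_ne_top (momentConst_ne_top p)
      (ENNReal.rpow_ne_top_of_nonneg (by norm_num)
        (hT.tsum_lintegral_klCoeff_sq_ne_top hS (by omega)))
    refine ⟨M.toReal + 1, by positivity, fun κ hκ _ => ?_⟩
    have h1 : truncErrorLp S T P p κ ≤ M := by
      refine (hT.truncErrorLp_le hS (by omega) hp κ).trans (mul_le_mul_right ?_ _)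
      exact ENNReal.rpow_le_rpow (ENNReal.tsum_comp_le_tsum_of_injective
        Subtype.val_injective _) (by norm_num)
    refine h1.trans ?_
    rw [← ENNReal.ofReal_toReal hMtop]
    refine ENNReal.ofReal_le_ofReal ?_
    rw [ENNReal.toReal_ofReal ENNReal.toReal_nonneg]
    have h2 : (1 : ℝ) ≤ (κ : ℝ) ^ (-((α + 1 - d) / 2)) :=
      Real.one_le_rpow (by exact_mod_cast hκ) (by linarith)
    nlinarith [M.toReal_nonneg]

/-- The almost sure rate of convergence. -/
theorem ae_eventually_truncError_le (hT : IsGaussianIsotropic T P)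
    (hS : IsSphericalHarmonics d S) (hd : 2 ≤ d) {A : ℕ → ℝ}
    (hA : IsAngularPowerSpectrum S T P A) {α C : ℝ} (hC : 0 < C) {ℓ₀ : ℕ}
    (hdecay : ∀ ℓ : ℕ, ℓ₀ < ℓ → A ℓ ≤ C * (ℓ : ℝ) ^ (-α)) {β : ℝ}
    (hβ : β < (α + 1 - d) / 2) :
    ∀ᵐ ω ∂P, ∀ᶠ κ : ℕ in atTop, truncError S T κ ω ≤ ENNReal.ofReal ((κ : ℝ) ^ (-β)) := by
  set γ := (α + 1 - d) / 2 with hγ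
  have hδ : 0 < γ - β := sub_pos.2 hβ
  -- Chosen so that (γ - β)p = (γ - β) + 2 > 1, which makes the Markov bounds summable.
  set p := 1 + 2 / (γ - β) with hp
  have hp1 : 1 ≤ p := by rw [hp]; linarith [div_pos two_pos hδ]
  have hp0 : 0 < p := by linarith
  obtain ⟨K, hK, hbound⟩ := hT.exists_truncErrorLp_le_rpow hS hd hA hC hdecay hp1
  set N := max 1 ℓ₀ with hN
  set B : ℕ → Set Ω := fun κ =>
    -- Requiring N ≤ κ empties the events where the L^p bound is unavailable, including κ = 0.
    {ω | N ≤ κ ∧ ENNReal.ofReal ((κ : ℝ) ^ (-β)) ≤ truncError S T κ ω} with hB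
  have hPB : ∀ κ, P (B κ) ≤ ENNReal.ofReal (K ^ p * (κ : ℝ) ^ (-((γ - β) * p))) := fun κ => by
    by_cases hκ : N ≤ κ
    · have hκ1 : 1 ≤ κ := (le_max_left _ _).trans hκ
      have hκ0 : (0 : ℝ) < κ := by exact_mod_cast hκ1
      have h1 := hbound κ hκ1 ((le_max_right _ _).trans hκ)
      have h2 : ∫⁻ ω, truncError S T κ ω ^ p ∂P ≤
          ENNReal.ofReal ((K * (κ : ℝ) ^ (-γ)) ^ p) := by
        have := ENNReal.rpow_le_rpow h1 hp0.le
        rwa [truncErrorLp, ← ENNReal.rpow_mul, one_div_mul_cancel hp0.ne', ENNReal.rpow_one,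
          ENNReal.ofReal_rpow_of_nonneg (by positivity) hp0.le] at this
      have h3 := mul_meas_ge_le_lintegral₀
        ((hT.aemeasurable_truncError hS (by omega) κ).pow_const p)
        (ENNReal.ofReal ((κ : ℝ) ^ (-β)) ^ p)
      have h4 : B κ ⊆ {ω | ENNReal.ofReal ((κ : ℝ) ^ (-β)) ^ p ≤ truncError S T κ ω ^ p} :=
        fun ω hω => ENNReal.rpow_le_rpow hω.2 hp0.le
      have h5 := (mul_le_mul_right (measure_mono h4) _).trans (h3.trans h2)
      rw [ENNReal.ofReal_rpow_of_nonneg (by positivity) hp0.le, mul_comm,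
        ← ENNReal.le_div_iff_mul_le (Or.inl (by simp; positivity)) (Or.inl (by simp)),
        ← ENNReal.ofReal_div_of_pos (by positivity)] at h5
      refine h5.trans (ENNReal.ofReal_le_ofReal (le_of_eq ?_))
      rw [Real.mul_rpow hK.le (by positivity), ← Real.rpow_mul hκ0.le, ← Real.rpow_mul hκ0.le,
        mul_div_assoc, ← Real.rpow_sub hκ0]
      congr 2
      ring
    · have : B κ = ∅ := by ext ω; simp [hB, hκ]
      simp [this]
  have hsum : ∑' κ, P (B κ) ≠ ∞ := by
    have hs : Summable fun κ : ℕ => K ^ p * (κ : ℝ) ^ (-((γ - β) * p)) := by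
      refine (Real.summable_nat_rpow.2 ?_).mul_left _
      have : (γ - β) * p = (γ - β) + 2 := by rw [hp]; field_simp
      linarith
    refine ne_top_of_le_ne_top ?_ (ENNReal.tsum_le_tsum hPB)
    rw [← ENNReal.ofReal_tsum_of_nonneg (fun κ => by positivity) hs]
    exact ENNReal.ofReal_ne_top
  -- Borel–Cantelli.
  filter_upwards [ae_eventually_notMem hsum] with ω hω
  filter_upwards [hω, eventually_ge_atTop N] with κ h1 h2
  by_contra! h3
  exact h1 ⟨h2, h3.le⟩

end IsGaussianIsotropic

end SphereField

theorem mainTheorem11 (d : ℕ) (hd : 2 ≤ d) (α C : ℝ) (hα : 2 < α) (hC : 0 < C) :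
    -- the constant depends on `d`, `p`, `α`, `C` only if `α > d - 1`
    (∀ p : ℝ, 1 ≤ p → (d : ℝ) - 1 < α →
      ∃ K : ℝ, 0 < K ∧
        ∀ (S : (ℓ : ℕ) → Fin (SphereField.harmDim ℓ d) → SphereField.Sph d → ℝ)
          (Ω : Type u) [MeasurableSpace Ω] (P : Measure Ω) [IsProbabilityMeasure P]
          (T : SphereField.Sph d → Ω → ℝ) (A : ℕ → ℝ) (ℓ₀ : ℕ),
          SphereField.IsSphericalHarmonics d S →
          SphereField.IsGaussianIsotropic T P →
          SphereField.IsAngularPowerSpectrum S T P A →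
          (∀ ℓ : ℕ, ℓ₀ < ℓ → A ℓ ≤ C * (ℓ : ℝ) ^ (-α)) →
          ∀ κ : ℕ, 1 ≤ κ → ℓ₀ ≤ κ →
            SphereField.truncErrorLp S T P p κ
              ≤ ENNReal.ofReal (K * (κ : ℝ) ^ (-((α + 1 - d) / 2)))) ∧
    -- the claims for a fixed field
    (∀ (S : (ℓ : ℕ) → Fin (SphereField.harmDim ℓ d) → SphereField.Sph d → ℝ)
        (Ω : Type u) [MeasurableSpace Ω] (P : Measure Ω) [IsProbabilityMeasure P]
        (T : SphereField.Sph d → Ω → ℝ) (A : ℕ → ℝ) (ℓ₀ : ℕ),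
        SphereField.IsSphericalHarmonics d S →
        SphereField.IsGaussianIsotropic T P →
        SphereField.IsAngularPowerSpectrum S T P A →
        (∀ ℓ : ℕ, ℓ₀ < ℓ → A ℓ ≤ C * (ℓ : ℝ) ^ (-α)) →
        (∀ p : ℝ, 1 ≤ p →
          Tendsto (SphereField.truncErrorLp S T P p) atTop (𝓝 0) ∧
          ∃ K : ℝ, 0 < K ∧ ∀ κ : ℕ, 1 ≤ κ → ℓ₀ ≤ κ →
            SphereField.truncErrorLp S T P p κ
              ≤ ENNReal.ofReal (K * (κ : ℝ) ^ (-((α + 1 - d) / 2)))) ∧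
        (∀ᵐ ω ∂P, Tendsto (fun κ => SphereField.truncError S T κ ω) atTop (𝓝 0)) ∧
        (∀ β : ℝ, β < (α + 1 - d) / 2 →
          ∀ᵐ ω ∂P, ∀ᶠ κ : ℕ in atTop,
            SphereField.truncError S T κ ω ≤ ENNReal.ofReal ((κ : ℝ) ^ (-β)))) := by
  have ht : ∀ x : ℝ, (d : ℝ) - 1 < x → 0 < x + 1 - d := fun x hx => by linarith
  refine ⟨fun p hp hαd => ?_, ?_⟩
  · have := ht α hαd
    -- The constant is fixed before S, Ω, P, T, A and ℓ₀ are introduced, so it cannot depend on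
    -- them.
    exact ⟨_, by positivity, fun S Ω _ P _ T A ℓ₀ hS hT hA hdecay κ hκ hℓ₀ =>
      hT.truncErrorLp_le_rpow hS hd hA hC hαd hdecay hp hκ hℓ₀⟩
  · intro S Ω _ P _ T A ℓ₀ hS hT hA hdecay
    exact ⟨fun p hp => ⟨hT.tendsto_truncErrorLp hS (by omega) hp,
        hT.exists_truncErrorLp_le_rpow hS hd hA hC hdecay hp⟩,
      hT.ae_tendsto_truncError hS (by omega),
      fun β hβ => hT.ae_eventually_truncError_le hS hd hA hC hdecay hβ⟩
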